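/- Let $A$ be the Clifford algebra generated by $\psi_i,\psi_i^*$ ($i\in\mathbb Z-\frac12$) with $[\psi_i,\psi_j]_+=[\psi_i^*,\psi_j^*]_+=0$ and $[\psi_i,\psi_j^*]_+=\delta_{i,j}$, where $[a,b]_+=ab+ba$. Let $\mathcal W_{\rm ann}$ be spanned by the $\psi_i^*$ with $i<0$ and the $\psi_i$ with $i>0$, and $\mathcal W_{\rm cr}$ by the $\psi_i^*$ with $i>0$ and the $\psi_i$ with $i<0$. Let $\mathcal F=A/A\mathcal W_{\rm ann}$ and $\mathcal F^*=\mathcal W_{\rm cr}A\backslash A$ be the Fock spaces, with the classes of $1$ denoted $|0\rangle$ and $\langle 0|$, and with the pairing $\langle 0|a\otimes b|0\rangle=\langle 0|ab|0\rangle$ normalized by $\langle 0|0\rangle=1$. For $q\in\mathbb Z$ let $J_q=\sum_{i\in\mathbb Z-\frac12}{:}\psi^*_{i-q}\psi_i{:}$ act on $\mathcal F$, where ${:}\psi_i^*\psi_j{:}$ is $\psi_i^*\psi_j$ if $i>0$ and $-\psi_j\psi_i^*$ if $i<0$, and put $$\phi_\pm(x;t)=\sum_{q\ge1}\frac1q\bigl(1-(-t)^q\bigr)x^{\pm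 q}J_{\pm q},\qquad e^{\phi}=\sum_{k\ge0}\frac{\phi^k}{k!}.$$ The parameters $x,t$ lie in any commutative $\mathbb Q$-algebra (over which all the objects above are taken), with $x$ invertible wherever negative powers of $x$ occur; they may be complex numbers or indeterminates. For a strictly decreasing sequence $\lambda=(\lambda_1>\dots>\lambda_n)$ of positive integers put $$|\lambda\rangle=\psi^*_{\lambda_1-\frac12}\cdots\psi^*_{\lambda_n-\frac12}|0\rangle,\qquad \langle\lambda|=\langle0|\psi_{\lambda_n-\frac12}\cdots\psi_{\lambda_1-\frac12},\qquad |\lambda|=\sum_i\lambda_i .$$ **Theorem.** Let $n\ge1$, let $\lambda=(\lambda_1,\dots,\lambda_n)$ and $\mu=(\mu_1,\dots,\mu_{n-1})$ be strictly decreasing sequences of positive integers, and let $k>\lambda_1$ be an integer. Put $$r=\#\{1\le i\le n-1:\mu_i=\lambda_{i+1}\},\quad l=\#\{1\le i\le n-1:\mu_i=\lambda_i\},\quad s=\#\{1\le i\le n-1:\lambda_i>\mu_i\}.$$ If $\lambda_i\ge\mu_i\ge\lambda_{i+1}$ for all $1\le i\le n-1$, then $$\langle\mu|e^{\phi_+(x;t)}\psi_{-\frac12}|\lambda\rangle=(-1)^n\,t^{r}(1+t)^{s-r+1}x^{|\lambda|-|\mu|},$$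 $$\langle\mu|\psi_{k-\frac12}e^{\phi_-(x;t)}|\lambda\rangle=t^{l}(1+t)^{s-r+1}x^{|\lambda|-|\mu|-k}.$$ Otherwise both matrix elements are zero. -/

import Mathlib

noncomputable section

namespace FreeFermion

open CliffordAlgebra MulOpposite

/-!
Half-integers are indexed by integers: the integer `k` stands for the half-integer `k - 1/2`.
So `psi k` is `ψ_{k-1/2}`, `psiStar k` is `ψ*_{k-1/2}`, and a half-integer is positive exactly
when its index satisfies `1 ≤ k`.  The coefficient ring `R` is any commutative `ℚ`-algebra, for
instance `ℂ` or a ring of (Laurent) polynomials over `ℂ` in which the parameters are indeterminates.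
-/

/-- The space `⊕ R ψ_i ⊕ ⊕ R ψ*_i` of free fermions: first the coordinates along the `ψ_i`,
then those along the `ψ*_i`. -/
abbrev W (R : Type*) [CommRing R] : Type _ := (ℤ →₀ R) × (ℤ →₀ R)

variable (R : Type*) [CommRing R]

/-- The bilinear form `(v, w) ↦ ∑ v_i w*_i`. -/
def dotForm : LinearMap.BilinForm R (W R) :=
  (Finsupp.linearCombination R
    (fun k : ℤ => (Finsupp.lapply k ∘ₗ LinearMap.snd R _ _ : W R →ₗ[R] R))) ∘ₗ
      LinearMap.fst R _ _

/-- The quadratic form `∑ a_i ψ_i + ∑ b_i ψ*_i ↦ ∑ a_i b_i`. -/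
def fermionForm : QuadraticForm R (W R) := LinearMap.BilinMap.toQuadraticMap (dotForm R)

/-- The Clifford algebra generated by the fermions `ψ_i`, `ψ*_i`. -/
abbrev A : Type _ := CliffordAlgebra (fermionForm R)

/-- The operator `ψ_{k-1/2}`. -/
def psi (k : ℤ) : A R := ι (fermionForm R) (Finsupp.single k 1, 0)

/-- The operator `ψ*_{k-1/2}`. -/
def psiStar (k : ℤ) : A R := ι (fermionForm R) (0, Finsupp.single k 1)

lemma polar_apply (v w : W R) :
    QuadraticMap.polar (fermionForm R) v w = dotForm R v w + dotForm R w v := by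
  simp only [fermionForm, QuadraticMap.polar, LinearMap.BilinMap.toQuadraticMap_apply, map_add,
    LinearMap.add_apply]
  ring

lemma psi_mul_ι_add (k : ℤ) (v : W R) :
    psi R k * ι (fermionForm R) v + ι (fermionForm R) v * psi R k
      = algebraMap R (A R) (v.2 k) := by
  rw [psi, ι_mul_ι_add_swap, polar_apply]
  simp [dotForm, Finsupp.linearCombination_apply]

lemma psiStar_mul_ι_add (k : ℤ) (v : W R) :
    psiStar R k * ι (fermionForm R) v + ι (fermionForm R) v * psiStar R k
      = algebraMap R (A R) (v.1 k) := by
  rw [psiStar, ι_mul_ι_add_swap, polar_apply]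
  simp [dotForm, Finsupp.linearCombination_apply, Finsupp.single_apply]

/-- `[ψ_i, ψ_j]_+ = 0`. -/
lemma psi_anticomm (i j : ℤ) : psi R i * psi R j + psi R j * psi R i = 0 := by
  simpa [psi] using psi_mul_ι_add R i (Finsupp.single j 1, 0)

/-- `[ψ*_i, ψ*_j]_+ = 0`. -/
lemma psiStar_anticomm (i j : ℤ) :
    psiStar R i * psiStar R j + psiStar R j * psiStar R i = 0 := by
  simpa [psiStar] using psiStar_mul_ι_add R i (0, Finsupp.single j 1)

/-- `[ψ_i, ψ*_j]_+ = δ_{ij}`. -/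
lemma psi_psiStar_anticomm (i j : ℤ) :
    psi R i * psiStar R j + psiStar R j * psi R i = if i = j then 1 else 0 := by
  have h := psi_mul_ι_add R i (0, Finsupp.single j 1)
  rw [← psiStar] at h
  rw [h]
  by_cases hij : i = j
  · subst hij; simp
  · simp [hij]

/-- The generators of `W_ann`: `ψ*_i` for `i < 0` and `ψ_i` for `i > 0`. -/
def annGen : Set (A R) := {a | ∃ k : ℤ, (k ≤ 0 ∧ a = psiStar R k) ∨ (1 ≤ k ∧ a = psi R k)}

/-- The generators of `W_cr`: `ψ*_i` for `i > 0` and `ψ_i` for `i < 0`. -/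
def crGen : Set (A R) := {a | ∃ k : ℤ, (1 ≤ k ∧ a = psiStar R k) ∨ (k ≤ 0 ∧ a = psi R k)}

/-- The left ideal `A W_ann`. -/
def annIdeal : Submodule (A R) (A R) := Submodule.span (A R) (annGen R)

/-- The right ideal `W_cr A`. -/
def crIdeal : Submodule (A R)ᵐᵒᵖ (A R) := Submodule.span (A R)ᵐᵒᵖ (crGen R)

/-- The Fock space `F = A / A W_ann`, a left `A`-module. -/
abbrev Fock : Type _ := A R ⧸ annIdeal R

/-- The dual Fock space `F* = W_cr A \ A`, a right `A`-module. -/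
abbrev FockDual : Type _ := A R ⧸ crIdeal R

/-- The vacuum `|0⟩`. -/
def vac : Fock R := Submodule.Quotient.mk 1

/-- The dual vacuum `⟨0|`. -/
def vacBra : FockDual R := Submodule.Quotient.mk 1

/-! ### The pairing of `F*` and `F` -/

/-- The two-point function `(v, w) ↦ ⟨0| v w |0⟩` on free fermions. -/
def twoPoint : LinearMap.BilinForm R (W R) :=
  (Finsupp.linearCombination R (fun k : ℤ =>
      if 1 ≤ k then (Finsupp.lapply k ∘ₗ LinearMap.snd R _ _ : W R →ₗ[R] R) else 0)) ∘ₗ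
        LinearMap.fst R _ _ +
  (Finsupp.linearCombination R (fun k : ℤ =>
      if k ≤ 0 then (Finsupp.lapply k ∘ₗ LinearMap.fst R _ _ : W R →ₗ[R] R) else 0)) ∘ₗ
        LinearMap.snd R _ _

lemma twoPoint_self (v : W R) : twoPoint R v v = fermionForm R v := by
  classical
  simp only [twoPoint, fermionForm, dotForm, LinearMap.BilinMap.toQuadraticMap_apply,
    LinearMap.add_apply, LinearMap.comp_apply, LinearMap.fst_apply, LinearMap.snd_apply,
    Finsupp.linearCombination_apply, Finsupp.sum, LinearMap.sum_apply, LinearMap.smul_apply,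
    smul_eq_mul, Finsupp.lapply_apply]
  have h1 : ∀ f : ℤ → R, ∑ k ∈ v.1.support, v.1 k * f k
      = ∑ k ∈ v.1.support ∪ v.2.support, v.1 k * f k := fun f =>
    Finset.sum_subset Finset.subset_union_left fun k _ hk => by
      rw [Finsupp.notMem_support_iff.mp hk, zero_mul]
  have h2 : ∀ f : ℤ → R, ∑ k ∈ v.2.support, v.2 k * f k
      = ∑ k ∈ v.1.support ∪ v.2.support, v.2 k * f k := fun f =>
    Finset.sum_subset Finset.subset_union_right fun k _ hk => by
      rw [Finsupp.notMem_support_iff.mp hk, zero_mul]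
  rw [h1, h1, h2, ← Finset.sum_add_distrib]
  refine Finset.sum_congr rfl fun k _ => ?_
  by_cases hk : 1 ≤ k
  · have : ¬ k ≤ 0 := by omega
    simp [hk, this]
  · have : k ≤ 0 := by omega
    simp [hk, this, mul_comm]

lemma neg_twoPoint_toQuadraticMap :
    LinearMap.BilinMap.toQuadraticMap (-twoPoint R) = 0 - fermionForm R := by
  ext v
  simp [twoPoint_self]

/-- Normal ordering: the linear isomorphism from `A` to the exterior algebra of `W` determined by
the two-point function. -/
def normalOrder : A R →ₗ[R] ExteriorAlgebra R (W R) :=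
  changeForm (neg_twoPoint_toQuadraticMap R)

/-- The vacuum expectation value `a ↦ ⟨0| a |0⟩`: the scalar part of the normally ordered form.
It is the linear functional on `A` that takes `1` to `1` and vanishes on `W_cr A` and on `A W_ann`;
see `vev_one`, `vev_of_mem_annIdeal` and `vev_of_mem_crIdeal`. -/
def vev : A R →ₗ[R] R :=
  (ExteriorAlgebra.algebraMapInv (R := R) (M := W R)).toLinearMap ∘ₗ normalOrder R

lemma vev_one : vev R 1 = 1 := by
  simp [vev, normalOrder]

lemma vev_ι_mul_of_twoPoint (v : W R) (hv : twoPoint R v = 0) (a : A R) :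
    vev R (ι (fermionForm R) v * a) = 0 := by
  have : ExteriorAlgebra.algebraMapInv (R := R) (M := W R) (ι (0 : QuadraticForm R (W R)) v) = 0 :=
    by simp [ExteriorAlgebra.algebraMapInv]
  simp [vev, normalOrder, changeForm_ι_mul, hv, this]

lemma contractLeft_mul_ι_of_eq_zero (d : Module.Dual R (W R)) (w : W R) (hw : d w = 0)
    (y : ExteriorAlgebra R (W R)) :
    contractLeft d (y * ι (0 : QuadraticForm R (W R)) w)
      = contractLeft d y * ι (0 : QuadraticForm R (W R)) w := by
  induction y using CliffordAlgebra.left_induction with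
  | algebraMap r => simp [contractLeft_algebraMap_mul, contractLeft_ι, hw, contractLeft_algebraMap]
  | add x y hx hy => simp [add_mul, hx, hy]
  | ι_mul x m hx =>
    rw [mul_assoc, contractLeft_ι_mul, contractLeft_ι_mul, hx, sub_mul, smul_mul_assoc, mul_assoc]

lemma vev_mul_ι_of_twoPoint (w : W R) (hw : ∀ v, twoPoint R v w = 0) (a : A R) :
    vev R (a * ι (fermionForm R) w) = 0 := by
  have key : normalOrder R (a * ι (fermionForm R) w)
      = normalOrder R a * ι (0 : QuadraticForm R (W R)) w := by
    induction a using CliffordAlgebra.left_induction with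
    | algebraMap r =>
      simp [normalOrder, ← Algebra.smul_def, changeForm_algebraMap, changeForm_ι]
    | add x y hx hy => simp [add_mul, hx, hy]
    | ι_mul x m hx =>
      simp only [normalOrder] at hx ⊢
      rw [mul_assoc, changeForm_ι_mul, changeForm_ι_mul, hx, contractLeft_mul_ι_of_eq_zero,
        sub_mul, mul_assoc]
      simp [hw]
  have : ExteriorAlgebra.algebraMapInv (R := R) (M := W R) (ι (0 : QuadraticForm R (W R)) w) = 0 :=
    by simp [ExteriorAlgebra.algebraMapInv]
  simp [vev, key, this]

lemma twoPoint_single_fst (k : ℤ) (w : W R) :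
    twoPoint R (Finsupp.single k 1, 0) w = if 1 ≤ k then w.2 k else 0 := by
  by_cases hk : 1 ≤ k <;> simp [twoPoint, hk]

lemma twoPoint_single_snd (k : ℤ) (w : W R) :
    twoPoint R (0, Finsupp.single k 1) w = if k ≤ 0 then w.1 k else 0 := by
  by_cases hk : k ≤ 0 <;> simp [twoPoint, hk]

lemma twoPoint_psi_right (k : ℤ) (hk : 1 ≤ k) (v : W R) :
    twoPoint R v (Finsupp.single k 1, 0) = 0 := by
  simp only [twoPoint, LinearMap.add_apply, LinearMap.comp_apply, LinearMap.fst_apply,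
    LinearMap.snd_apply, Finsupp.linearCombination_apply, Finsupp.sum, LinearMap.sum_apply,
    LinearMap.smul_apply]
  rw [Finset.sum_eq_zero, Finset.sum_eq_zero, add_zero]
  · intro j _
    split_ifs with hj
    · have : j ≠ k := by omega
      simp [this]
    · simp
  · intro j _
    split_ifs <;> simp

lemma twoPoint_psiStar_right (k : ℤ) (hk : k ≤ 0) (v : W R) :
    twoPoint R v (0, Finsupp.single k 1) = 0 := by
  simp only [twoPoint, LinearMap.add_apply, LinearMap.comp_apply, LinearMap.fst_apply,
    LinearMap.snd_apply, Finsupp.linearCombination_apply, Finsupp.sum, LinearMap.sum_apply,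
    LinearMap.smul_apply]
  rw [Finset.sum_eq_zero, Finset.sum_eq_zero, add_zero]
  · intro j _
    split_ifs <;> simp
  · intro j _
    split_ifs with hj
    · have : j ≠ k := by omega
      simp [this]
    · simp

lemma vev_crGen_mul {c : A R} (hc : c ∈ crGen R) (a : A R) : vev R (c * a) = 0 := by
  obtain ⟨k, ⟨hk, rfl⟩ | ⟨hk, rfl⟩⟩ := hc
  · exact vev_ι_mul_of_twoPoint R _ (LinearMap.ext fun w => by
      rw [twoPoint_single_snd, if_neg (by omega), LinearMap.zero_apply]) a
  · exact vev_ι_mul_of_twoPoint R _ (LinearMap.ext fun w => by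
      rw [twoPoint_single_fst, if_neg (by omega), LinearMap.zero_apply]) a

lemma vev_mul_annGen {c : A R} (hc : c ∈ annGen R) (a : A R) : vev R (a * c) = 0 := by
  obtain ⟨k, ⟨hk, rfl⟩ | ⟨hk, rfl⟩⟩ := hc
  · exact vev_mul_ι_of_twoPoint R _ (twoPoint_psiStar_right R k hk) a
  · exact vev_mul_ι_of_twoPoint R _ (twoPoint_psi_right R k hk) a

lemma vev_of_mem_annIdeal {b : A R} (hb : b ∈ annIdeal R) (a : A R) : vev R (a * b) = 0 := by
  induction hb using Submodule.span_induction generalizing a with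
  | zero => simp
  | add x y _ _ hx hy => simp [mul_add, hx, hy]
  | mem x hx => exact vev_mul_annGen R hx a
  | smul b x _ hx => rw [smul_eq_mul, ← mul_assoc]; exact hx _

lemma vev_of_mem_crIdeal {a : A R} (ha : a ∈ crIdeal R) (b : A R) : vev R (a * b) = 0 := by
  induction ha using Submodule.span_induction generalizing b with
  | zero => simp
  | add x y _ _ hx hy => simp [add_mul, hx, hy]
  | mem x hx => exact vev_crGen_mul R hx b
  | smul c x _ hx => rw [← op_unop c, op_smul_eq_mul, mul_assoc]; exact hx _

/-- The map `F → Hom(A, R)`, `b|0⟩ ↦ (a ↦ ⟨0| a b |0⟩)`. -/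
def pairingAux : Fock R →ₗ[R] A R →ₗ[R] R :=
  ((annIdeal R).restrictScalars R).liftQ ((LinearMap.mul R (A R)).compr₂ (vev R)).flip
      (fun b hb => LinearMap.ext fun a => by
        simpa using vev_of_mem_annIdeal R hb a) ∘ₗ
    (Submodule.Quotient.restrictScalarsEquiv R (annIdeal R)).symm.toLinearMap

/-- The pairing of `F*` and `F`, which sends `⟨0| a` and `b |0⟩` to `⟨0| a b |0⟩`. -/
def pairing : FockDual R →ₗ[R] Fock R →ₗ[R] R :=
  ((crIdeal R).restrictScalars R).liftQ (pairingAux R).flip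
      (fun a ha => LinearMap.ext fun v => by
        obtain ⟨b, rfl⟩ := Submodule.Quotient.mk_surjective _ v
        exact vev_of_mem_crIdeal R ha b) ∘ₗ
    (Submodule.Quotient.restrictScalarsEquiv R (crIdeal R)).symm.toLinearMap

lemma pairing_mk (a b : A R) :
    pairing R (Submodule.Quotient.mk a) (Submodule.Quotient.mk b) = vev R (a * b) := rfl

/-- The pairing is defined on `F* ⊗_A F`. -/
lemma pairing_smul (m : FockDual R) (a : A R) (v : Fock R) :
    pairing R (op a • m) v = pairing R m (a • v) := by
  obtain ⟨b, rfl⟩ := Submodule.Quotient.mk_surjective _ m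
  obtain ⟨c, rfl⟩ := Submodule.Quotient.mk_surjective _ v
  rw [← Submodule.Quotient.mk_smul, ← Submodule.Quotient.mk_smul, pairing_mk, pairing_mk,
    op_smul_eq_mul, smul_eq_mul, mul_assoc]

lemma pairing_vac : pairing R (vacBra R) (vac R) = 1 := by
  rw [vacBra, vac, pairing_mk, mul_one, vev_one]

/-! ### The operators `J_n` -/

/-- The normally ordered product `:ψ*_{i-1/2} ψ_{j-1/2}:`. -/
def nord (i j : ℤ) : A R :=
  if 1 ≤ i then psiStar R i * psi R j else -(psi R j * psiStar R i)

lemma exists_kill (v : Fock R) :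
    ∃ N : ℤ, ∀ k : ℤ, N ≤ k → psi R k • v = 0 ∧ psiStar R (-k) • v = 0 := by
  obtain ⟨a, rfl⟩ := Submodule.Quotient.mk_surjective _ v
  induction a using CliffordAlgebra.left_induction with
  | algebraMap r =>
    refine ⟨1, fun k hk => ?_⟩
    constructor <;>
    · rw [← Submodule.Quotient.mk_smul, Submodule.Quotient.mk_eq_zero, smul_eq_mul,
        ← Algebra.commutes, ← smul_eq_mul]
      refine Submodule.smul_mem _ _ (Submodule.subset_span ?_)
      first
        | exact ⟨k, Or.inr ⟨hk, rfl⟩⟩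
        | exact ⟨-k, Or.inl ⟨by omega, rfl⟩⟩
  | add x y hx hy =>
    obtain ⟨M, hM⟩ := hx
    obtain ⟨N, hN⟩ := hy
    refine ⟨max M N, fun k hk => ?_⟩
    have h1 := hM k (le_trans (le_max_left _ _) hk)
    have h2 := hN k (le_trans (le_max_right _ _) hk)
    rw [Submodule.Quotient.mk_add, smul_add, smul_add, h1.1, h1.2, h2.1, h2.2, add_zero]
    exact ⟨rfl, rfl⟩
  | ι_mul x w hx =>
    obtain ⟨N, hN⟩ := hx
    obtain ⟨B, hB⟩ : ∃ B : ℤ, ∀ k, B ≤ k → w.2 k = 0 := by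
      obtain ⟨B, hB⟩ := w.2.support.bddAbove
      exact ⟨B + 1, fun k hk => by
        by_contra h
        have := hB (Finsupp.mem_support_iff.mpr h)
        omega⟩
    obtain ⟨C, hC⟩ : ∃ C : ℤ, ∀ k, k ≤ C → w.1 k = 0 := by
      obtain ⟨C, hC⟩ := w.1.support.bddBelow
      exact ⟨C - 1, fun k hk => by
        by_contra h
        have := hC (Finsupp.mem_support_iff.mpr h)
        omega⟩
    refine ⟨max N (max B (-C)), fun k hk => ?_⟩
    simp only [max_le_iff] at hk
    obtain ⟨h1, h2⟩ := hN k hk.1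
    have e1 := psi_mul_ι_add R k w
    have e2 := psiStar_mul_ι_add R (-k) w
    rw [hB k hk.2.1, map_zero] at e1
    rw [hC (-k) (by omega), map_zero] at e2
    have m : (Submodule.Quotient.mk (ι (fermionForm R) w * x) : Fock R)
      = ι (fermionForm R) w • Submodule.Quotient.mk x := rfl
    rw [m, smul_smul, smul_smul, eq_neg_of_add_eq_zero_left e1, eq_neg_of_add_eq_zero_left e2,
      neg_smul, neg_smul, mul_smul, mul_smul, h1, h2, smul_zero, neg_zero]
    exact ⟨rfl, rfl⟩

/-- Only finitely many terms of the sum defining `J_n v` are nonzero. -/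
lemma J_support_finite (n : ℤ) (v : Fock R) :
    (Function.support fun k : ℤ => nord R (k - n) k • v).Finite := by
  obtain ⟨N, hN⟩ := exists_kill R v
  refine (Set.finite_Icc (min n (n - N)) (max N (n + 1))).subset fun k hk => ?_
  by_contra hmem
  apply hk
  rw [Set.mem_Icc, not_and_or, not_le, not_le] at hmem
  rcases hmem with h | h
  · have h1 : ¬ 1 ≤ k - n := by omega
    have h2 := (hN (-(k - n)) (by omega)).2
    rw [neg_neg] at h2
    simp only [nord, if_neg h1, neg_smul, mul_smul, h2, smul_zero, neg_zero]
  · have h1 : 1 ≤ k - n := by omega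
    simp only [nord, if_pos h1, mul_smul, (hN k (by omega)).1, smul_zero]

/-- The operator `J_n = ∑_i :ψ*_{i-n} ψ_i:` on the Fock space; on every vector only finitely many
terms act nontrivially. -/
def J (n : ℤ) : Module.End R (Fock R) where
  toFun v := ∑ᶠ k : ℤ, nord R (k - n) k • v
  map_add' v w := by
    simp only [smul_add]
    exact finsum_add_distrib (J_support_finite R n v) (J_support_finite R n w)
  map_smul' r v := by
    rw [RingHom.id_apply, smul_finsum' r (J_support_finite R n v)]
    exact finsum_congr fun k => smul_comm _ _ _

/-! ### Bra-kets with exponentials -/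

/-- The matrix element `⟨m| e^H |v⟩` for `H = ∑_{q ≥ 1} H_q`, with the exponential expanded as
`e^H = ∑_k (1/k!) ∑_{q_1, ..., q_k ≥ 1} H_{q_1} ⋯ H_{q_k}`; the sum is over the lists
`(q_1, ..., q_k)` of positive integers of all lengths `k ≥ 0`.  If every `H_q` is a multiple of
`J_q`, or every `H_q` is a multiple of `J_{-q}`, only finitely many lists contribute;
see `braExpKet_support_finite`. -/
def braExpKet [Algebra ℚ R] (m : FockDual R) (H : ℕ+ → Module.End R (Fock R)) (v : Fock R) : R :=
  ∑ᶠ L : List ℕ+, (1 / (L.length.factorial : ℚ)) • pairing R m ((L.map H).prod v)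

/-- A letter `(true, k)` stands for `ψ*_{k-1/2}`, and `(false, k)` for `ψ_{k-1/2}`. -/
def letter (g : Bool × ℤ) : A R := if g.1 then psiStar R g.2 else psi R g.2

/-- The degree of a letter. -/
def letterDeg (g : Bool × ℤ) : ℤ := if g.1 then g.2 else -g.2

/-- The span of the words of length at most `N` and degree `d`. -/
def wordSpan (N : ℕ) (d : ℤ) : Submodule R (A R) :=
  Submodule.span R {a | ∃ L : List (Bool × ℤ), L.length ≤ N ∧ (L.map letterDeg).sum = d ∧
    (L.map (letter R)).prod = a}

lemma word_mem (L : List (Bool × ℤ)) :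
    (L.map (letter R)).prod ∈ wordSpan R L.length (L.map letterDeg).sum :=
  Submodule.subset_span ⟨L, le_rfl, rfl, rfl⟩

lemma wordSpan_mono {M N : ℕ} (h : M ≤ N) (d : ℤ) : wordSpan R M d ≤ wordSpan R N d :=
  Submodule.span_mono fun _ ⟨L, h1, h2⟩ => ⟨L, h1.trans h, h2⟩

lemma word_mul_mem {M : ℕ} {e : ℤ} (L : List (Bool × ℤ)) {x : A R} (hx : x ∈ wordSpan R M e) :
    (L.map (letter R)).prod * x ∈ wordSpan R (L.length + M) ((L.map letterDeg).sum + e) := by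
  induction hx using Submodule.span_induction with
  | zero => simp
  | add x y _ _ hx hy => rw [mul_add]; exact add_mem hx hy
  | smul r x _ hx => rw [mul_smul_comm]; exact Submodule.smul_mem _ _ hx
  | mem x hx =>
    obtain ⟨K, h1, h2, rfl⟩ := hx
    exact Submodule.subset_span ⟨L ++ K, by simpa using h1, by simp [h2], by simp⟩

lemma letter_anticomm (g h : Bool × ℤ) : ∃ r : R, (letterDeg g + letterDeg h = 0 ∨ r = 0) ∧
    letter R g * letter R h = -(letter R h * letter R g) + r • 1 := by
  obtain ⟨b, i⟩ := g
  obtain ⟨c, j⟩ := h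
  cases b <;> cases c
  · exact ⟨0, Or.inr rfl, by
      simpa [letter] using eq_neg_of_add_eq_zero_left (psi_anticomm R i j)⟩
  · have h := psi_psiStar_anticomm R i j
    by_cases hij : i = j
    · refine ⟨1, Or.inl (by simp [letterDeg, hij]), ?_⟩
      rw [if_pos hij] at h
      simpa [letter, sub_eq_neg_add] using eq_sub_of_add_eq h
    · refine ⟨0, Or.inr rfl, ?_⟩
      rw [if_neg hij] at h
      simpa [letter] using eq_neg_of_add_eq_zero_left h
  · have h := psi_psiStar_anticomm R j i
    rw [add_comm] at h
    by_cases hij : j = i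
    · refine ⟨1, Or.inl (by simp [letterDeg, hij]), ?_⟩
      rw [if_pos hij] at h
      simpa [letter, sub_eq_neg_add] using eq_sub_of_add_eq h
    · refine ⟨0, Or.inr rfl, ?_⟩
      rw [if_neg hij] at h
      simpa [letter] using eq_neg_of_add_eq_zero_left h
  · exact ⟨0, Or.inr rfl, by
      simpa [letter] using eq_neg_of_add_eq_zero_left (psiStar_anticomm R i j)⟩

lemma letter_mul_word (g : Bool × ℤ) (L : List (Bool × ℤ)) : ∃ c : R, ∃ y : A R,
    (∃ M, M ≤ L.length ∧ y ∈ wordSpan R M (letterDeg g + (L.map letterDeg).sum)) ∧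
    letter R g * (L.map (letter R)).prod = c • ((L.map (letter R)).prod * letter R g) + y := by
  induction L with
  | nil => exact ⟨1, 0, ⟨0, le_rfl, zero_mem _⟩, by simp⟩
  | cons h L ih =>
    obtain ⟨c, y, ⟨M, hM, hy⟩, e⟩ := ih
    obtain ⟨r, hr, e'⟩ := letter_anticomm R g h
    refine ⟨-c, -(letter R h * y) + r • (L.map (letter R)).prod,
      ⟨L.length + 1, by simp, ?_⟩, ?_⟩
    · refine add_mem (neg_mem ?_) ?_
      · have := word_mul_mem R [h] hy
        simp only [List.map_cons, List.map_nil, List.prod_singleton, List.sum_singleton,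
          List.length_singleton] at this
        convert wordSpan_mono R (show 1 + M ≤ L.length + 1 by omega) _ this using 2
        simp only [List.map_cons, List.sum_cons]; ring
      · rcases hr with hr | rfl
        · have := wordSpan_mono R (Nat.le_succ _) _ (word_mem R L)
          refine Submodule.smul_mem _ _ ?_
          convert this using 2
          simp only [List.map_cons, List.sum_cons]; omega
        · simp
    · simp only [List.map_cons, List.prod_cons]
      rw [← mul_assoc, e', add_mul, neg_mul, mul_assoc, e]
      simp only [mul_add, mul_smul_comm, neg_add, smul_mul_assoc, one_mul, neg_smul, mul_assoc]
      abel

lemma letter_mem (g : Bool × ℤ) : letter R g ∈ crGen R ∨ letter R g ∈ annGen R := by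
  obtain ⟨b, k⟩ := g
  rcases le_or_gt 1 k with hk | hk <;> cases b
  · exact Or.inr ⟨k, Or.inr ⟨hk, rfl⟩⟩
  · exact Or.inl ⟨k, Or.inl ⟨hk, rfl⟩⟩
  · exact Or.inl ⟨k, Or.inr ⟨by omega, rfl⟩⟩
  · exact Or.inr ⟨k, Or.inl ⟨by omega, rfl⟩⟩

lemma vev_wordSpan (N : ℕ) {d : ℤ} (hd : d ≠ 0) {x : A R} (hx : x ∈ wordSpan R N d) :
    vev R x = 0 := by
  induction N using Nat.strong_induction_on generalizing x with
  | _ N ih =>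
  induction hx using Submodule.span_induction with
  | zero => simp
  | add x y _ _ hx hy => rw [map_add, hx, hy, add_zero]
  | smul r x _ hx => rw [map_smul, hx, smul_zero]
  | mem x hx =>
    obtain ⟨L, h1, h2, rfl⟩ := hx
    cases L with
    | nil => exact absurd h2 (by simpa using hd.symm)
    | cons g L =>
      rw [List.map_cons, List.prod_cons]
      rcases letter_mem R g with hg | hg
      · exact vev_crGen_mul R hg _
      · obtain ⟨c, y, ⟨M, hM, hy⟩, e⟩ := letter_mul_word R g L
        rw [List.map_cons, List.sum_cons] at h2
        rw [h2] at hy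
        rw [List.length_cons] at h1
        rw [e, map_add, map_smul, vev_mul_annGen R hg, ih M (by omega) hy, smul_zero, add_zero]

/-- The span of all words of degree `d`. -/
def degSpan (d : ℤ) : Submodule R (A R) :=
  Submodule.span R {a | ∃ L : List (Bool × ℤ), (L.map letterDeg).sum = d ∧
    (L.map (letter R)).prod = a}

lemma degSpan_mul {d e : ℤ} {x y : A R} (hx : x ∈ degSpan R d) (hy : y ∈ degSpan R e) :
    x * y ∈ degSpan R (d + e) := by
  have := Submodule.mul_mem_mul hx hy
  rw [degSpan, degSpan, Submodule.span_mul_span] at this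
  refine Submodule.span_mono ?_ this
  rintro _ ⟨_, ⟨L, h1, rfl⟩, _, ⟨K, h2, rfl⟩, rfl⟩
  exact ⟨L ++ K, by simp [h1, h2], by simp⟩

lemma vev_degSpan {d : ℤ} (hd : d ≠ 0) {x : A R} (hx : x ∈ degSpan R d) : vev R x = 0 := by
  induction hx using Submodule.span_induction with
  | zero => simp
  | add x y _ _ hx hy => rw [map_add, hx, hy, add_zero]
  | smul r x _ hx => rw [map_smul, hx, smul_zero]
  | mem x hx =>
    obtain ⟨L, h2, rfl⟩ := hx
    exact vev_wordSpan R L.length hd (h2 ▸ word_mem R L)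

lemma mem_iSup_degSpan (a : A R) : a ∈ ⨆ d, degSpan R d := by
  have hword : ∀ L : List (Bool × ℤ), (L.map (letter R)).prod ∈ ⨆ d, degSpan R d := fun L =>
    Submodule.mem_iSup_of_mem _ (Submodule.subset_span ⟨L, rfl, rfl⟩)
  have hletter : ∀ (g : Bool × ℤ) (x : A R), x ∈ ⨆ d, degSpan R d →
      letter R g * x ∈ ⨆ d, degSpan R d := by
    intro g x hx
    induction hx using Submodule.iSup_induction' with
    | zero => simp
    | add x y _ _ hx hy => rw [mul_add]; exact add_mem hx hy
    | mem d x hx =>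
      exact Submodule.mem_iSup_of_mem (letterDeg g + d) (degSpan_mul R
        (Submodule.subset_span ⟨[g], by simp, by simp⟩) hx)
  induction a using CliffordAlgebra.left_induction with
  | algebraMap r =>
    rw [Algebra.algebraMap_eq_smul_one]
    exact Submodule.smul_mem _ _ (by simpa using hword [])
  | add x y hx hy => exact add_mem hx hy
  | ι_mul x w hx =>
    obtain ⟨u, v⟩ := w
    have e : ((u, v) : W R) = LinearMap.inl R _ _ u + LinearMap.inr R _ _ v := by simp
    rw [e, map_add, add_mul]
    refine add_mem ?_ ?_
    · induction u using Finsupp.induction_linear with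
      | zero => rw [map_zero, map_zero, zero_mul]; exact zero_mem _
      | add f g hf hg =>
        rw [map_add, map_add, add_mul]
        exact add_mem (hf (by simp)) (hg (by simp))
      | single k r =>
        have : LinearMap.inl R (ℤ →₀ R) (ℤ →₀ R) (Finsupp.single k r)
          = r • (Finsupp.single k 1, 0) := by simp
        rw [this, map_smul, smul_mul_assoc]
        exact Submodule.smul_mem _ _ (hletter (false, k) x hx)
    · induction v using Finsupp.induction_linear with
      | zero => rw [map_zero, map_zero, zero_mul]; exact zero_mem _
      | add f g hf hg =>
        rw [map_add, map_add, add_mul]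
        exact add_mem (hf (by simp)) (hg (by simp))
      | single k r =>
        have : LinearMap.inr R (ℤ →₀ R) (ℤ →₀ R) (Finsupp.single k r)
          = r • (0, Finsupp.single k 1) := by simp
        rw [this, map_smul, smul_mul_assoc]
        exact Submodule.smul_mem _ _ (hletter (true, k) x hx)

lemma nord_mem (n k : ℤ) : nord R (k - n) k ∈ degSpan R (-n) := by
  unfold nord
  split_ifs
  · exact Submodule.subset_span ⟨[(true, k - n), (false, k)], by simp [letterDeg]; try ring,
      by simp [letter]⟩
  · exact neg_mem (Submodule.subset_span ⟨[(false, k), (true, k - n)], by simp [letterDeg]; try ring,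
      by simp [letter]⟩)

/-- The vectors of degree `d` in the Fock space. -/
def fockDeg (d : ℤ) : Submodule R (Fock R) :=
  (degSpan R d).map ((annIdeal R).mkQ.restrictScalars R)

lemma smul_fockDeg {d e : ℤ} {a : A R} (ha : a ∈ degSpan R d) {v : Fock R}
    (hv : v ∈ fockDeg R e) : a • v ∈ fockDeg R (d + e) := by
  obtain ⟨b, hb, rfl⟩ := hv
  exact ⟨a * b, degSpan_mul R ha hb, rfl⟩

lemma J_fockDeg (n d : ℤ) {v : Fock R} (hv : v ∈ fockDeg R d) : J R n v ∈ fockDeg R (-n + d) := by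
  change (∑ᶠ k : ℤ, nord R (k - n) k • v) ∈ _
  exact finsum_induction (p := fun w => w ∈ fockDeg R (-n + d)) (zero_mem _)
    (fun _ _ => add_mem) fun k => smul_fockDeg R (nord_mem R n k) hv

lemma finite_lists_sum (N : ℤ) : {L : List ℕ+ | (L.map fun q : ℕ+ => ((q : ℕ) : ℤ)).sum = N}.Finite := by
  have h : {L : List ℕ+ | (L.map fun q : ℕ+ => ((q : ℕ) : ℤ)).sum = N} ⊆
      (List.map (fun q : ℕ+ => (q : ℕ))) ⁻¹'
        Set.range (fun c : Composition N.toNat => c.blocks) := by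
    intro L hL
    refine ⟨⟨L.map (fun q : ℕ+ => (q : ℕ)), ?_, ?_⟩, rfl⟩
    · intro i hi
      obtain ⟨q, _, rfl⟩ := List.mem_map.mp hi
      exact q.pos
    · have : (((L.map fun q : ℕ+ => (q : ℕ)).sum : ℕ) : ℤ) = N := by
        rw [← hL, Nat.cast_list_sum, List.map_map]; rfl
      omega
  exact ((Set.finite_range _).preimage
    (List.map_injective_iff.mpr PNat.coe_injective).injOn).subset h

/-- The sum defining `braExpKet` is finite. -/
lemma braExpKet_support_finite [Algebra ℚ R] (m : FockDual R) (s : ℕ+ → R) (ε : ℤ) (hε : ε ≠ 0)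
    (v : Fock R) :
    (Function.support fun L : List ℕ+ => (1 / (L.length.factorial : ℚ)) •
      pairing R m ((L.map fun q => s q • J R (ε * q)).prod v)).Finite := by
  have hprod : ∀ (L : List ℕ+) (d : ℤ) (v : Fock R), v ∈ fockDeg R d →
      (L.map fun q => s q • J R (ε * q)).prod v ∈
        fockDeg R (-(ε * (L.map fun q : ℕ+ => ((q : ℕ) : ℤ)).sum) + d) := by
    intro L
    induction L with
    | nil => intro d v hv; simpa using hv
    | cons q L ih =>
      intro d v hv
      simp only [List.map_cons, List.prod_cons, List.sum_cons, Module.End.mul_apply,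
        LinearMap.smul_apply]
      refine Submodule.smul_mem _ _ ?_
      convert J_fockDeg R (ε * q) _ (ih d v hv) using 2
      ring
  obtain ⟨a, rfl⟩ := Submodule.Quotient.mk_surjective _ m
  obtain ⟨b, rfl⟩ := Submodule.Quotient.mk_surjective _ v
  suffices h : (Function.support fun L : List ℕ+ => pairing R (Submodule.Quotient.mk a)
      ((L.map fun q => s q • J R (ε * q)).prod (Submodule.Quotient.mk b))).Finite by
    refine h.subset fun L hL h0 => hL ?_
    beta_reduce at h0 ⊢
    rw [h0, smul_zero]
  induction mem_iSup_degSpan R a using Submodule.iSup_induction' with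
  | zero => simp
  | add x y _ _ hx hy =>
    refine (hx.union hy).subset fun L hL => ?_
    by_contra hmem
    rw [Set.mem_union, not_or, Function.notMem_support, Function.notMem_support] at hmem
    exact hL (by
      simp only [Submodule.Quotient.mk_add, map_add, LinearMap.add_apply, hmem.1, hmem.2, add_zero])
  | mem e a ha =>
    induction mem_iSup_degSpan R b using Submodule.iSup_induction' with
    | zero => simp
    | add x y _ _ hx hy =>
      refine (hx.union hy).subset fun L hL => ?_
      by_contra hmem
      rw [Set.mem_union, not_or, Function.notMem_support, Function.notMem_support] at hmem
      exact hL (by simp only [Submodule.Quotient.mk_add, map_add, hmem.1, hmem.2, add_zero])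
    | mem d b hb =>
      refine (finite_lists_sum ((e + d) / ε)).subset fun L hL => ?_
      obtain ⟨c, hc, hc'⟩ := hprod L d _ ⟨b, hb, rfl⟩
      have hc'' : (L.map fun q => s q • J R (ε * q)).prod (Submodule.Quotient.mk b)
        = (Submodule.Quotient.mk c : Fock R) := hc'.symm
      have h0 : e + (-(ε * (L.map fun q : ℕ+ => ((q : ℕ) : ℤ)).sum) + d) = 0 := by
        by_contra h
        apply hL
        simp only [hc'', pairing_mk]
        exact vev_degSpan R h (degSpan_mul R ha hc)
      refine (Int.ediv_eq_of_eq_mul_right hε ?_).symm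
      linarith

/-! ### The operators `φ_±` and the states -/

/-- The summand of index `q` of `φ_+(x;t) = ∑_{q ≥ 1} (1/q) (1 - (-t)^q) x^q J_q`. -/
def phiPlus [Algebra ℚ R] (x t : R) (q : ℕ+) : Module.End R (Fock R) :=
  ((1 / (q : ℚ)) • ((1 - (-t) ^ (q : ℕ)) * x ^ (q : ℕ))) • J R q

/-- The summand of index `q` of `φ_-(x;t) = ∑_{q ≥ 1} (1/q) (1 - (-t)^q) x^{-q} J_{-q}`. -/
def phiMinus [Algebra ℚ R] (x : Rˣ) (t : R) (q : ℕ+) : Module.End R (Fock R) :=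
  ((1 / (q : ℚ)) • ((1 - (-t) ^ (q : ℕ)) * ((x⁻¹ : Rˣ) : R) ^ (q : ℕ))) • J R (-q)

/-- The state `|λ⟩ = ψ*_{λ_1-1/2} ψ*_{λ_2-1/2} ⋯ ψ*_{λ_n-1/2} |0⟩`. -/
def ket {n : ℕ} (lam : Fin n → ℕ) : Fock R :=
  (List.ofFn fun i => psiStar R (lam i)).prod • vac R

/-- The dual state `⟨λ| = ⟨0| ψ_{λ_n-1/2} ⋯ ψ_{λ_2-1/2} ψ_{λ_1-1/2}`. -/
def bra {n : ℕ} (lam : Fin n → ℕ) : FockDual R :=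
  op (List.ofFn fun i => psi R (lam i)).reverse.prod • vacBra R

/-! ### The combinatorial data -/

/-- `μ` interlaces `λ`: `λ_i ≥ μ_i ≥ λ_{i+1}` for all `i`. -/
def Interlaces {n : ℕ} (lam : Fin (n + 1) → ℕ) (mu : Fin n → ℕ) : Prop :=
  ∀ i : Fin n, mu i ≤ lam i.castSucc ∧ lam i.succ ≤ mu i

/-- `r(λ; μ) = |{i : μ_i = λ_{i+1}}|`. -/
def rStat {n : ℕ} (lam : Fin (n + 1) → ℕ) (mu : Fin n → ℕ) : ℕ :=
  (Finset.univ.filter fun i : Fin n => mu i = lam i.succ).card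

/-- `l(λ; μ) = |{i : μ_i = λ_i}|`. -/
def lStat {n : ℕ} (lam : Fin (n + 1) → ℕ) (mu : Fin n → ℕ) : ℕ :=
  (Finset.univ.filter fun i : Fin n => mu i = lam i.castSucc).card

/-- `s(λ; μ) = |{i : λ_i > μ_i}|`. -/
def sStat {n : ℕ} (lam : Fin (n + 1) → ℕ) (mu : Fin n → ℕ) : ℕ :=
  (Finset.univ.filter fun i : Fin n => mu i < lam i.castSucc).card

end FreeFermion
end

namespace FreeFermion

/-! Conjugation by the exponential acts on fermions by scalar series. Since `[J_n, ψ*_j] = ψ*_{j-n}`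
and `[J_n, ψ_j] = -ψ_{j+n}`, and since `∑ (1/q)(1 - (-t)^q) x^q X^q` is the logarithm of `h(X) = (1
+ txX)/(1 - xX)`, conjugating `ψ*_j` by `e^{φ_+}` gives `∑ h_p ψ*_{j-p}`, and conjugating `ψ_j`
gives the analogous sum with the coefficients of `1/h`. For `φ_-` the fermions `ψ_j` are moved to
the right through the exponential, again with the coefficients of `h`. The exponential is then
absorbed by a vacuum: `φ_+` kills `|0⟩`, and `⟨0|` kills `φ_-`. Everything is done degree by degree,
with `X` recording the degree, so no infinite sum of operators occurs (`exp_intertwine`,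
`IsExpConj`, `IsInvConj`).

What remains is a vacuum expectation value of a product of fermions, which Wick's theorem turns into
a determinant of pairwise anticommutators (`wick_det`, `wick_det_left`). The powers of `xX` factor
out of rows and columns (`det_mul_pow`). The remaining entries are `0`, `1` or `1 + t` according to
the sign of `λ_j - μ_i` (of `μ_i - λ_j` for `φ_-`), and the extra fermion contributes a constant
row: `-(1 + t)` for `ψ_{-1/2}`, and `1 + t` for `ψ_{k-1/2}`, because `k` exceeds every `λ_j`.

Subtracting adjacent columns reduces the constant row to one entry (`det_const_row`). In the
remaining `μ × λ` block an entry vanishes unless `μ_i` lies between `λ_{j+1}` and `λ_j`. As `λ` and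
`μ` decrease strictly, only the identity permutation can then contribute
(`det_eq_prod_diag_of_interlacing`). The diagonal product vanishes without interlacing, and
otherwise it gives the stated powers of `t` and `1 + t`. -/

open Finset PowerSeries

/-! ### Compositions and sums over antidiagonals -/

/-- The lists of `k` positive integers with sum `N`. -/
def listsOf : ℕ → ℕ → Finset (List ℕ+)
  | 0, N => if N = 0 then {[]} else ∅
  | k + 1, N => (range N).biUnion fun i => (listsOf k (N - (i + 1))).image (List.cons i.succPNat)

lemma mem_listsOf {k N : ℕ} {L : List ℕ+} :
    L ∈ listsOf k N ↔ L.length = k ∧ (L.map fun q : ℕ+ => (q : ℕ)).sum = N := by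
  induction k generalizing N L with
  | zero =>
    rw [listsOf, List.length_eq_zero_iff]
    split_ifs with h
    · subst h; simp +contextual
    · simp only [notMem_empty, false_iff, not_and]
      rintro rfl
      simpa using Ne.symm h
  | succ k ih =>
    simp only [listsOf, mem_biUnion, Finset.mem_range, mem_image, ih]
    constructor
    · rintro ⟨i, hi, L, ⟨h1, h2⟩, rfl⟩
      refine ⟨by simp [h1], ?_⟩
      simp only [List.map_cons, List.sum_cons, h2, Nat.succPNat_coe]
      omega
    · rintro ⟨h1, h2⟩
      obtain _ | ⟨q, L⟩ := L
      · simp at h1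
      · simp only [List.map_cons, List.sum_cons, List.length_cons] at h1 h2
        have := q.pos
        refine ⟨q - 1, by omega, L, ⟨by omega, by omega⟩, ?_⟩
        congr 1
        exact PNat.eq (by rw [Nat.succPNat_coe]; omega)

lemma sum_listsOf_succ {M : Type*} [AddCommMonoid M] (k N : ℕ) (F : List ℕ+ → M) :
    ∑ L ∈ listsOf (k + 1) N, F L
      = ∑ i ∈ range N, ∑ L ∈ listsOf k (N - (i + 1)), F (i.succPNat :: L) := by
  rw [listsOf, sum_biUnion]
  · exact sum_congr rfl fun i _ => sum_image fun _ _ _ _ h => (List.cons.inj h).2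
  · intro i _ j _ hij
    rw [Function.onFun, disjoint_left]
    rintro _ h1 h2
    obtain ⟨L, _, rfl⟩ := mem_image.mp h1
    obtain ⟨K, _, h⟩ := mem_image.mp h2
    exact hij (Nat.succPNat_injective (List.cons.inj h).1).symm

lemma sum_antidiagonal_swap_right {M : Type*} [AddCommMonoid M] (f : ℕ → ℕ → ℕ → M) (N : ℕ) :
    ∑ p ∈ HasAntidiagonal.antidiagonal N, ∑ s ∈ HasAntidiagonal.antidiagonal p.2, f p.1 s.1 s.2
      = ∑ p ∈ HasAntidiagonal.antidiagonal N, ∑ s ∈ HasAntidiagonal.antidiagonal p.2,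
          f s.1 p.1 s.2 := by
  rw [sum_sigma', sum_sigma']
  refine sum_bij' (fun a _ => ⟨(a.2.1, a.1.1 + a.2.2), (a.1.1, a.2.2)⟩)
    (fun a _ => ⟨(a.2.1, a.1.1 + a.2.2), (a.1.1, a.2.2)⟩) ?_ ?_ ?_ ?_ ?_ <;>
  · rintro ⟨⟨a, b⟩, ⟨c, d⟩⟩ h
    simp only [mem_sigma, HasAntidiagonal.mem_antidiagonal] at h
    obtain ⟨h1, h2⟩ := h
    subst h2 h1
    simp [add_left_comm]

lemma sum_antidiagonal_assoc {M : Type*} [AddCommMonoid M] (f : ℕ → ℕ → ℕ → M) (N : ℕ) :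
    ∑ p ∈ HasAntidiagonal.antidiagonal N, ∑ s ∈ HasAntidiagonal.antidiagonal p.2, f p.1 s.1 s.2
      = ∑ p ∈ HasAntidiagonal.antidiagonal N, ∑ s ∈ HasAntidiagonal.antidiagonal p.1,
          f s.1 s.2 p.2 := by
  rw [sum_sigma', sum_sigma']
  refine sum_bij' (fun a _ => ⟨(a.1.1 + a.2.1, a.2.2), (a.1.1, a.2.1)⟩)
    (fun a _ => ⟨(a.2.1, a.2.2 + a.1.2), (a.2.2, a.1.2)⟩) ?_ ?_ ?_ ?_ ?_ <;>
  · rintro ⟨⟨a, b⟩, ⟨c, d⟩⟩ h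
    simp only [mem_sigma, HasAntidiagonal.mem_antidiagonal] at h
    obtain ⟨h1, h2⟩ := h
    subst h2 h1
    simp [add_assoc]

/-! ### The exponential of a graded family, degree by degree -/

section Exponential

variable {B : Type*} [Ring B]

/-- The power series `∑_{q ≥ 1} H_q X^q`. -/
noncomputable def seriesOf (H : ℕ+ → B) : B⟦X⟧ :=
  PowerSeries.mk fun n => if h : 0 < n then H ⟨n, h⟩ else 0

lemma coeff_seriesOf_zero (H : ℕ+ → B) : coeff 0 (seriesOf H) = 0 := by
  simp [seriesOf]

lemma coeff_seriesOf_succ (H : ℕ+ → B) (n : ℕ) : coeff (n + 1) (seriesOf H) = H n.succPNat := by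
  simp [seriesOf]; rfl

lemma coeff_seriesOf_mul (H : ℕ+ → B) (f : B⟦X⟧) (N : ℕ) :
    coeff N (seriesOf H * f) = ∑ i ∈ range N, H i.succPNat * coeff (N - (i + 1)) f := by
  rw [coeff_mul, Nat.sum_antidiagonal_eq_sum_range_succ
    (fun i j => coeff i (seriesOf H) * coeff j f), sum_range_succ']
  simp [coeff_seriesOf_zero, coeff_seriesOf_succ]

lemma coeff_seriesOf_pow (H : ℕ+ → B) (k N : ℕ) :
    coeff N (seriesOf H ^ k) = ∑ L ∈ listsOf k N, (L.map H).prod := by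
  induction k generalizing N with
  | zero => rw [pow_zero, coeff_one, listsOf]; split_ifs <;> simp
  | succ k ih =>
    simp only [pow_succ', coeff_seriesOf_mul, sum_listsOf_succ, ih, List.map_cons, List.prod_cons,
      mul_sum]

lemma coeff_seriesOf_pow_of_lt (H : ℕ+ → B) {k N : ℕ} (h : N < k) :
    coeff N (seriesOf H ^ k) = 0 := by
  induction k generalizing N with
  | zero => omega
  | succ k ih =>
    rw [pow_succ', coeff_seriesOf_mul]
    exact sum_eq_zero fun i hi => by
      rw [Finset.mem_range] at hi; rw [ih (by omega), mul_zero]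

/-- The operator `X d/dX` on power series. -/
noncomputable def eulerOp (f : B⟦X⟧) : B⟦X⟧ := PowerSeries.mk fun n => n • coeff n f

lemma coeff_eulerOp (f : B⟦X⟧) (n : ℕ) : coeff n (eulerOp f) = n • coeff n f := by
  simp [eulerOp]

lemma eulerOp_mul (f g : B⟦X⟧) : eulerOp (f * g) = eulerOp f * g + f * eulerOp g := by
  ext n
  simp only [map_add, coeff_mul, coeff_eulerOp, ← sum_add_distrib, smul_sum]
  refine sum_congr rfl fun p hp => ?_
  rw [HasAntidiagonal.mem_antidiagonal] at hp
  rw [← hp, add_smul, smul_mul_assoc, mul_smul_comm]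

lemma eulerOp_pow_succ {f : B⟦X⟧} (h : Commute f (eulerOp f)) (k : ℕ) :
    eulerOp (f ^ (k + 1)) = (k + 1) • (eulerOp f * f ^ k) := by
  induction k with
  | zero => simp
  | succ k ih =>
    rw [pow_succ', eulerOp_mul, ih, mul_smul_comm, ← mul_assoc, h.eq, mul_assoc, ← pow_succ',
      ← succ_nsmul']

variable (R : Type*) [CommRing R] [Algebra ℚ R] [Algebra R B]

/-- The component of degree `N` of `exp (∑_{q ≥ 1} H_q)`, where `H_q` has degree `q`. -/
noncomputable def expCoeff (H : ℕ+ → B) (N : ℕ) : B :=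
  ∑ k ∈ range (N + 1), algebraMap ℚ R (1 / k.factorial) • coeff N (seriesOf H ^ k)

lemma expCoeff_zero (H : ℕ+ → B) : expCoeff R H 0 = 1 := by
  simp [expCoeff]

omit [Algebra R B] in
lemma eq_of_nsmul_eq {M : Type*} [AddCommGroup M] [Module R M] {N : ℕ} (hN : N ≠ 0) {x y : M}
    (h : N • x = N • y) : x = y := by
  have key : ∀ z : M, algebraMap ℚ R (1 / N) • N • z = z := fun z => by
    rw [← Nat.cast_smul_eq_nsmul R N z, smul_smul, ← map_natCast (algebraMap ℚ R), ← map_mul,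
      one_div_mul_cancel (Nat.cast_ne_zero.mpr hN), map_one, one_smul]
  rw [← key x, h, key]

/-- This is `X d/dX e^f = (X f') e^f` read off in degree `N`; it needs `f` to commute with its
derivative. Over a `ℚ`-algebra the recursion determines the exponential from its constant term, and
it replaces the definition in most later arguments. -/
lemma nsmul_expCoeff {H : ℕ+ → B} (hH : ∀ p q, Commute (H p) (H q)) (N : ℕ) :
    N • expCoeff R H N
      = ∑ i ∈ range N, (i + 1) • (H i.succPNat * expCoeff R H (N - (i + 1))) := by
  have hc : Commute (seriesOf H) (eulerOp (seriesOf H)) := by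
    ext n
    rw [coeff_mul, coeff_mul, ← Nat.sum_antidiagonal_swap]
    refine sum_congr rfl fun p _ => ?_
    simp only [coeff_eulerOp, Prod.fst_swap, Prod.snd_swap]
    rw [smul_mul_assoc, mul_smul_comm]
    congr 1
    obtain ⟨_ | a, _ | b⟩ := p <;>
      simp only [coeff_seriesOf_zero, coeff_seriesOf_succ, mul_zero, zero_mul]
    exact hH _ _
  have he : ∀ (f : B⟦X⟧), coeff N (eulerOp (seriesOf H) * f)
      = ∑ i ∈ range N, (i + 1) • (H i.succPNat * coeff (N - (i + 1)) f) := fun f => by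
    rw [coeff_mul, Nat.sum_antidiagonal_eq_sum_range_succ
      (fun i j => coeff i (eulerOp (seriesOf H)) * coeff j f), sum_range_succ']
    simp [coeff_eulerOp, coeff_seriesOf_succ, mul_assoc]
  have hterm : ∀ k, N • algebraMap ℚ R (1 / (k + 1).factorial) • coeff N (seriesOf H ^ (k + 1))
      = algebraMap ℚ R (1 / k.factorial) • coeff N (eulerOp (seriesOf H) * seriesOf H ^ k) := by
    intro k
    rw [smul_comm, ← coeff_eulerOp, eulerOp_pow_succ hc, map_nsmul,
      ← Nat.cast_smul_eq_nsmul R, smul_smul, ← map_natCast (algebraMap ℚ R), ← map_mul]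
    congr 2
    rw [Nat.factorial_succ]
    have := Nat.cast_ne_zero (R := ℚ).mpr k.factorial_ne_zero
    push_cast
    field_simp
  rw [expCoeff, sum_range_succ', smul_add, smul_sum, sum_congr rfl fun k _ => hterm k]
  -- The term `k = 0` lives in degree `0`, where the factor `N` kills it.
  have h0 : N • algebraMap ℚ R (1 / (Nat.factorial 0)) • coeff N (seriesOf H ^ 0) = 0 := by
    rw [pow_zero, coeff_one]
    split_ifs with h
    · rw [h, zero_smul]
    · simp
  rw [h0, add_zero]
  simp only [he, smul_sum]
  rw [sum_comm]
  refine sum_congr rfl fun i hi => ?_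
  rw [Finset.mem_range] at hi
  rw [expCoeff, mul_sum, smul_sum]
  -- The inner range can be cut from `N` down to `N - (i + 1) + 1`, because a series without
  -- constant term has `k`-th power of order at least `k`.
  refine (sum_subset_zero_on_sdiff (range_subset_range.mpr (by omega)) (fun k hk => ?_)
    fun k _ => ?_).symm
  · simp only [mem_sdiff, Finset.mem_range, not_lt] at hk
    rw [coeff_seriesOf_pow_of_lt _ (by omega), mul_zero, smul_zero, smul_zero]
  · rw [mul_smul_comm, smul_comm]

lemma commute_expCoeff {H : ℕ+ → B} (hH : ∀ p q, Commute (H p) (H q)) (p : ℕ+) (N : ℕ) :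
    Commute (H p) (expCoeff R H N) := by
  refine Commute.sum_right _ _ _ fun k _ => (Commute.smul_right · _) ?_
  rw [coeff_seriesOf_pow]
  refine Commute.sum_right _ _ _ fun L _ => Commute.list_prod_right _ _ fun x hx => ?_
  obtain ⟨q, _, rfl⟩ := List.mem_map.mp hx
  exact hH p q

/-- Conjugation by the exponential of `∑ H_q` when `[H_q, w_p] = c_q w_{p+q}`. -/
lemma exp_intertwine {H : ℕ+ → B} {E : ℕ → B}
    (hE0 : E 0 = 1)
    (hE : ∀ N, N • E N = ∑ i ∈ range N, (i + 1) • (H i.succPNat * E (N - (i + 1))))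
    (c : ℕ+ → R) (h : ℕ → R) (h0 : h 0 = 1)
    (hh : ∀ N : ℕ, (N : R) * h N = ∑ i ∈ range N, ((i : R) + 1) * (c i.succPNat * h (N - (i + 1))))
    (w : ℕ → B) (hw : ∀ (q : ℕ+) p, H q * w p = w p * H q + c q • w (p + q)) (N : ℕ) :
    E N * w 0 = ∑ p ∈ HasAntidiagonal.antidiagonal N, h p.1 • (w p.1 * E p.2) := by
  induction N using Nat.strong_induction_on with
  | _ N ih =>
  rcases Nat.eq_zero_or_pos N with rfl | hN
  · simp [h0, hE0]
  refine eq_of_nsmul_eq R hN.ne' ?_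
  have hEs : ∀ N, N • E N = ∑ p ∈ HasAntidiagonal.antidiagonal N, coeff p.1 (eulerOp (seriesOf H)) * E p.2 := by
    intro N
    rw [hE, Nat.sum_antidiagonal_eq_sum_range_succ
      (fun i j => coeff i (eulerOp (seriesOf H)) * E j), sum_range_succ']
    simp [coeff_eulerOp, coeff_seriesOf_succ, mul_assoc]
  have hhs : ∀ N : ℕ, (N : R) * h N
      = ∑ p ∈ HasAntidiagonal.antidiagonal N, coeff p.1 (eulerOp (seriesOf c)) * h p.2 := by
    intro N
    rw [hh, Nat.sum_antidiagonal_eq_sum_range_succ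
      (fun i j => coeff i (eulerOp (seriesOf c)) * h j), sum_range_succ']
    simp [coeff_eulerOp, coeff_seriesOf_succ, mul_assoc]
  have hws : ∀ q p, coeff q (eulerOp (seriesOf H)) * w p
      = w p * coeff q (eulerOp (seriesOf H)) + coeff q (eulerOp (seriesOf c)) • w (p + q) := by
    intro q p
    rcases q with _ | q
    · simp [coeff_eulerOp]
    · simp only [coeff_eulerOp, coeff_seriesOf_succ, smul_mul_assoc, mul_smul_comm, hw, smul_add,
        smul_assoc, Nat.succPNat_coe, Nat.succ_eq_add_one]
  -- The recursion exposes a leftmost factor `H`, and induction handles the smaller `E`. Moving `H`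
  -- past `w` then yields two sums: in one, `H` recombines with `E` by the recursion for `E`; in the
  -- other, the scalars `c` recombine with `h` by the recursion for `h`. They carry the weights
  -- `p.2` and `p.1`, which add up to `N`.
  have step : N • E N * w 0 = ∑ p ∈ HasAntidiagonal.antidiagonal N, ∑ s ∈ HasAntidiagonal.antidiagonal p.2,
      coeff p.1 (eulerOp (seriesOf H)) * (h s.1 • (w s.1 * E s.2)) := by
    rw [hEs, sum_mul]
    refine sum_congr rfl fun p hp => ?_
    rw [HasAntidiagonal.mem_antidiagonal] at hp
    rcases Nat.eq_zero_or_pos p.1 with h1 | h1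
    · simp [h1, coeff_eulerOp]
    · rw [mul_assoc, ih p.2 (by omega), mul_sum]
  have e1 : ∀ p : ℕ × ℕ, ∀ s : ℕ × ℕ, coeff p.1 (eulerOp (seriesOf H)) * (h s.1 • (w s.1 * E s.2))
      = h s.1 • (w s.1 * (coeff p.1 (eulerOp (seriesOf H)) * E s.2))
        + (coeff p.1 (eulerOp (seriesOf c)) * h s.1) • (w (s.1 + p.1) * E s.2) := by
    intro p s
    rw [mul_smul_comm, ← mul_assoc, hws, add_mul, smul_add, mul_assoc, smul_mul_assoc, smul_smul,
      mul_comm (h s.1)]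
  rw [← smul_mul_assoc, step]
  simp only [e1, sum_add_distrib]
  have a1 : ∑ p ∈ HasAntidiagonal.antidiagonal N, ∑ s ∈ HasAntidiagonal.antidiagonal p.2,
      h s.1 • (w s.1 * (coeff p.1 (eulerOp (seriesOf H)) * E s.2))
      = ∑ p ∈ HasAntidiagonal.antidiagonal N, p.2 • h p.1 • (w p.1 * E p.2) := by
    rw [sum_antidiagonal_swap_right
      fun a b d => h b • (w b * (coeff a (eulerOp (seriesOf H)) * E d))]
    refine sum_congr rfl fun p _ => ?_
    rw [← smul_sum, ← mul_sum, ← hEs, mul_smul_comm, smul_comm]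
  have a2 : ∑ p ∈ HasAntidiagonal.antidiagonal N, ∑ s ∈ HasAntidiagonal.antidiagonal p.2,
      (coeff p.1 (eulerOp (seriesOf c)) * h s.1) • (w (s.1 + p.1) * E s.2)
      = ∑ p ∈ HasAntidiagonal.antidiagonal N, p.1 • h p.1 • (w p.1 * E p.2) := by
    rw [sum_antidiagonal_assoc
      fun a b d => (coeff a (eulerOp (seriesOf c)) * h b) • (w (b + a) * E d)]
    refine sum_congr rfl fun p _ => ?_
    rw [← Nat.cast_smul_eq_nsmul R, smul_smul, hhs, sum_smul]
    refine sum_congr rfl fun s hs => ?_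
    rw [HasAntidiagonal.mem_antidiagonal] at hs
    rw [add_comm s.2, hs]
  rw [a1, a2, ← sum_add_distrib, smul_sum]
  refine sum_congr rfl fun p hp => ?_
  rw [HasAntidiagonal.mem_antidiagonal] at hp
  rw [← add_smul, add_comm p.2, hp]

end Exponential

/-! ### Wick's theorem as a determinant -/

section Wick

variable {B S : Type*} [Ring B] [CommRing S] (σ : S →+* B)

/-- Moving `v` to the right through a product of elements that anticommute with it up to
central scalars. -/
lemma mul_prod_ofFn_of_anticomm (hσ : ∀ s b, Commute (σ s) b) (v : B) {m : ℕ}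
    (w : Fin (m + 1) → B) (s : Fin (m + 1) → S) (h : ∀ j, v * w j + w j * v = σ (s j)) :
    v * (List.ofFn w).prod
      = ∑ j : Fin (m + 1), σ ((-1) ^ (j : ℕ) * s j) * (List.ofFn fun i => w (j.succAbove i)).prod
        + (-1) ^ (m + 1) * ((List.ofFn w).prod * v) := by
  induction m with
  | zero =>
    simp [← h 0]
  | succ m ih =>
    have e : (List.ofFn w).prod = w 0 * (List.ofFn fun i : Fin (m + 1) => w i.succ).prod := by
      rw [List.ofFn_succ, List.prod_cons]
    rw [e, ← mul_assoc, eq_sub_of_add_eq (h 0), sub_mul, mul_assoc,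
      ih (fun i => w i.succ) (fun i => s i.succ) fun i => h i.succ, Fin.sum_univ_succ (n := m + 1)]
    have e2 : ∀ j : Fin (m + 1), σ ((-1) ^ (j.succ : ℕ) * s j.succ)
          * (List.ofFn fun i => w (j.succ.succAbove i)).prod
        = -(w 0 * (σ ((-1) ^ (j : ℕ) * s j.succ)
          * (List.ofFn fun i => w (j.succAbove i).succ).prod)) := by
      intro j
      rw [List.ofFn_succ, List.prod_cons, ← mul_assoc (w 0), ← (hσ _ _).eq]
      simp [pow_succ, mul_assoc]
    have e3 : Commute (w 0) ((-1 : B) ^ (m + 1)) := (Commute.neg_one_right _).pow_right _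
    rw [sum_congr rfl fun j _ => e2 j, sum_neg_distrib, mul_add, mul_sum,
      ← mul_assoc (w 0) ((-1) ^ (m + 1)), e3.eq, pow_succ _ (m + 1)]
    simp only [Fin.succAbove_zero, Fin.val_zero, pow_zero, one_mul]
    noncomm_ring

/-- Wick's theorem for a product of annihilation operators followed by a product of creation
operators. -/
lemma wick_det (hσ : ∀ s b, Commute (σ s) b) (ε : B →+ S) (hε : ∀ s b, ε (σ s * b) = s * ε b)
    (hε1 : ε 1 = 1) {m : ℕ} (v w : Fin m → B) (s : Matrix (Fin m) (Fin m) S)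
    (h : ∀ i j, v i * w j + w j * v i = σ (s i j)) (hv : ∀ i b, ε (b * v i) = 0) :
    ε ((List.ofFn v).reverse.prod * (List.ofFn w).prod) = s.det := by
  induction m with
  | zero => simp [hε1]
  | succ m ih =>
    have e1 : (List.ofFn v).reverse.prod
        = (List.ofFn fun i : Fin m => v i.succ).reverse.prod * v 0 := by
      rw [List.ofFn_succ, List.reverse_cons, List.prod_append, List.prod_singleton]
    -- Once `v 0` has passed through every `w j` it stands at the far right, where `ε` kills it. The
    -- contractions left behind form the Laplace expansion along row `0`.
    have e2 : ∀ P W : B, ε (P * ((-1) ^ (m + 1) * (W * v 0))) = 0 := fun P W => by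
      rw [← mul_assoc, ← mul_assoc]; exact hv 0 _
    rw [e1, mul_assoc, mul_prod_ofFn_of_anticomm σ hσ (v 0) w (s 0) (h 0), mul_add, map_add, e2,
      add_zero, mul_sum, map_sum, Matrix.det_succ_row_zero]
    refine sum_congr rfl fun j _ => ?_
    rw [← mul_assoc, ← (hσ _ _).eq, mul_assoc, hε,
      ih (fun i => v i.succ) (fun i => w (j.succAbove i)) (s.submatrix Fin.succ j.succAbove)
        (fun _ _ => h _ _) fun _ => hv _]

/-- Wick's theorem, with the creation operators characterized by their action on the dual
vacuum. -/
lemma wick_det_left (hσ : ∀ s b, Commute (σ s) b) (ε : B →+ S)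
    (hε : ∀ s b, ε (σ s * b) = s * ε b) (hε1 : ε 1 = 1) {m : ℕ} (v w : Fin m → B)
    (s : Matrix (Fin m) (Fin m) S) (h : ∀ i j, v i * w j + w j * v i = σ (s i j))
    (hw : ∀ i b, ε (w i * b) = 0) :
    ε ((List.ofFn v).reverse.prod * (List.ofFn w).prod) = s.det := by
  -- In the opposite ring left and right are exchanged, so `w` plays the part of the annihilation
  -- operators and the matrix is transposed.
  have key := wick_det (σ.toOpposite fun x y => hσ x (σ y))
    (fun r b => MulOpposite.unop_injective (hσ r b.unop).eq.symm)
    (ε.comp (MulOpposite.opAddEquiv (α := B)).symm.toAddMonoidHom)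
    (fun r b => by
      have := hε r b.unop
      rw [(hσ _ _).eq] at this
      simpa using this)
    (by simpa using hε1) (fun i => MulOpposite.op (w i)) (fun i => MulOpposite.op (v i)) s.transpose
    (fun i j => MulOpposite.unop_injective (by simpa using h j i))
    (fun i b => by simpa using hw i b.unop)
  rw [Matrix.det_transpose] at key
  rw [← key]
  simp [MulOpposite.unop_list_prod, List.map_ofFn, Function.comp_def, List.map_reverse]

end Wick

/-! ### Evaluation of the determinants -/

section Determinant

variable {S : Type*} [CommRing S]

/-- The factor `x ^ (a j - b i)` is a column factor divided by a row factor, but `x` need not be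
invertible. The argument therefore runs over permutations: a term that does not vanish has no
truncated subtraction in it. -/
lemma det_mul_pow (x : S) {m : ℕ} (a b : Fin m → ℕ) (H : Matrix (Fin m) (Fin m) S)
    (hH : ∀ i j, H i j ≠ 0 → b i ≤ a j) :
    (Matrix.of fun i j => H i j * x ^ (a j - b i)).det = H.det * x ^ ((∑ j, a j) - ∑ i, b i) := by
  rw [Matrix.det_apply, Matrix.det_apply, sum_mul]
  refine sum_congr rfl fun τ _ => ?_
  simp only [Matrix.of_apply]
  rw [smul_mul_assoc, prod_mul_distrib, prod_pow_eq_pow_sum]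
  by_cases h : ∀ i, b (τ i) ≤ a i
  · rw [sum_tsub_distrib _ fun i _ => h i, Equiv.sum_comp τ b]
  · push Not at h
    obtain ⟨i, hi⟩ := h
    have : ∏ i, H (τ i) i = 0 := prod_eq_zero (mem_univ i) (by
      by_contra h0
      exact absurd (hH _ _ h0) (by omega))
    simp [this]

/-- Subtracting from each column its predecessor turns the constant row into `(u, 0, …, 0)`; then
expand along it. -/
lemma det_const_row {n : ℕ} (u : S) (f : Fin n → Fin (n + 1) → S) :
    (Matrix.of (Fin.cons (fun _ => u) f : Fin (n + 1) → Fin (n + 1) → S)).det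
      = u * (Matrix.of fun i j => f i j.succ - f i j.castSucc).det := by
  rw [Matrix.det_eq_of_forall_col_eq_smul_add_pred
    (B := Matrix.of fun i j => Fin.cases
      ((Fin.cons (fun _ => u) f : Fin (n + 1) → Fin (n + 1) → S) i 0)
      (fun j : Fin n => (Fin.cons (fun _ => u) f : Fin (n + 1) → Fin (n + 1) → S) i j.succ
        - (Fin.cons (fun _ => u) f : Fin (n + 1) → Fin (n + 1) → S) i j.castSucc) j)
    (fun _ => 1) (fun i => by simp) (fun i j => by simp),
    Matrix.det_succ_row_zero, Fin.sum_univ_succ]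
  have h0 : ∀ j : Fin n, (Fin.cons (fun _ => u) f : Fin (n + 1) → Fin (n + 1) → S) 0 j.succ
    - (Fin.cons (fun _ => u) f : Fin (n + 1) → Fin (n + 1) → S) 0 j.castSucc = 0 := fun j => by simp
  simp only [Matrix.of_apply, Fin.cases_zero, Fin.cases_succ, h0]
  simp only [Fin.val_zero, pow_zero, one_mul, mul_zero, zero_mul, sum_const_zero, add_zero,
    Fin.cons_zero]
  congr 2

/-- If `τ` contributes and `i < j`, then `b (τ j) ≤ a_j ≤ a_{i+1} ≤ b (τ i)`. Hence `τ` is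
increasing, and so it is the identity. -/
lemma det_eq_prod_diag_of_interlacing {n : ℕ} (a : Fin (n + 1) → ℕ) (ha : StrictAnti a)
    (b : Fin n → ℕ) (hb : StrictAnti b) (M : Matrix (Fin n) (Fin n) S)
    (hM : ∀ i j, M i j ≠ 0 → b i ≤ a j.castSucc ∧ a j.succ ≤ b i) :
    M.det = ∏ i, M i i := by
  rw [Matrix.det_apply, sum_eq_single 1]
  · simp
  · intro τ _ hτ
    by_contra h
    have hne : ∀ i, M (τ i) i ≠ 0 := fun i h0 => h (by
      rw [show ∏ i, M (τ i) i = 0 from prod_eq_zero (mem_univ i) h0, smul_zero])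
    have hmono : StrictMono τ := fun i j hij => by
      have h1 := (hM _ _ (hne i)).2
      have h2 := (hM _ _ (hne j)).1
      have h3 : a j.castSucc ≤ a i.succ := ha.antitone (by
        rw [Fin.le_def]; simpa using hij)
      have h4 : τ i ≤ τ j := hb.le_iff_ge.mp (by omega)
      exact lt_of_le_of_ne h4 fun h => hij.ne (τ.injective h)
    apply hτ
    ext i
    rw [congrFun (hmono.range_inj strictMono_id |>.mp
      (by rw [τ.surjective.range_eq, Set.range_id])) i]
    rfl
  · simp

/-- The coefficient of `X ^ (a - b)` in `(1 + t X) / (1 - X)`. -/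
def hWt (t : S) (a b : ℕ) : S := if a < b then 0 else if a = b then 1 else 1 + t

lemma le_of_hWt_ne_zero {t : S} {a b : ℕ} (h : hWt t a b ≠ 0) : b ≤ a := by
  by_contra hab
  exact h (if_pos (by omega))

lemma hWt_of_lt {t : S} {a b : ℕ} (h : b < a) : hWt t a b = 1 + t := by
  rw [hWt, if_neg (by omega), if_neg (by omega)]

/-- Strict decrease of `λ` makes the indices counted by `r` a subset of those counted by `s`, so the
subtraction is not truncated. Under interlacing it counts the `i` with `λ_i > μ_i > λ_{i+1}`. -/
lemma sStat_sub_rStat {n : ℕ} {lam : Fin (n + 1) → ℕ} (hlam : StrictAnti lam) {mu : Fin n → ℕ} :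
    sStat lam mu - rStat lam mu
      = #{i : Fin n | mu i < lam i.castSucc ∧ mu i ≠ lam i.succ} := by
  have : sStat lam mu = rStat lam mu
      + #{i : Fin n | mu i < lam i.castSucc ∧ mu i ≠ lam i.succ} := by
    rw [sStat, rStat, ← card_union_of_disjoint]
    · congr 1
      ext i
      have := hlam i.castSucc_lt_succ
      simp only [mem_filter, mem_univ, true_and, mem_union]
      omega
    · rw [disjoint_left]
      intro i
      simp +contextual
  omega

lemma prod_ite_const {n : ℕ} (c : S) (p : Fin n → Prop) [DecidablePred p] :
    ∏ i, (if p i then c else 1) = c ^ #{i | p i} := by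
  rw [← prod_filter, prod_const]

lemma det_hWt_plus {n : ℕ} (lam : Fin (n + 1) → ℕ) (hlam : StrictAnti lam)
    (mu : Fin n → ℕ) (hmu : StrictAnti mu) (t : S) :
    (Interlaces lam mu → (Matrix.of (Fin.cons (fun _ => -(1 + t))
        (fun i j => hWt t (lam j) (mu i)) : Fin (n + 1) → Fin (n + 1) → S)).det
      = (-1) ^ (n + 1) * t ^ rStat lam mu * (1 + t) ^ (sStat lam mu - rStat lam mu + 1)) ∧
    (¬ Interlaces lam mu → (Matrix.of (Fin.cons (fun _ => -(1 + t))
        (fun i j => hWt t (lam j) (mu i)) : Fin (n + 1) → Fin (n + 1) → S)).det = 0) := by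
  rw [det_const_row, det_eq_prod_diag_of_interlacing lam hlam mu hmu]
  · constructor
    · intro h
      -- The difference is `1 - (1 + t) = -t` if `μ_i = λ_{i+1}`, `0 - 1` if `μ_i = λ_i`, and `0 -
      -- (1 + t)` strictly in between.
      have key : ∀ i : Fin n, hWt t (lam i.succ) (mu i) - hWt t (lam i.castSucc) (mu i)
          = -1 * (if mu i = lam i.succ then t else 1)
            * (if mu i < lam i.castSucc ∧ mu i ≠ lam i.succ then 1 + t else 1) := by
        intro i
        obtain ⟨h1, h2⟩ := h i
        have h3 := hlam i.castSucc_lt_succ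
        simp only [hWt]
        rcases h1.eq_or_lt with h1 | h1 <;> rcases h2.eq_or_lt with h2 | h2
        · omega
        · simp [h1, show lam i.succ < lam i.castSucc from h3, h3.ne']
        · rw [← h2] at h1
          simp [← h2, h1, h1.ne', not_lt.mpr h1.le]
        · simp [h1, h1.ne', h2, h2.ne', not_lt.mpr h1.le]
      simp only [Matrix.of_apply, key]
      rw [prod_mul_distrib, prod_mul_distrib, prod_ite_const, prod_ite_const, prod_const,
        card_univ, Fintype.card_fin, ← sStat_sub_rStat hlam, ← rStat]
      ring
    · intro h
      simp only [Interlaces, not_forall] at h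
      obtain ⟨i, hi⟩ := h
      rw [prod_eq_zero (mem_univ i), mul_zero]
      have h3 := hlam i.castSucc_lt_succ
      simp only [Matrix.of_apply, hWt]
      split_ifs <;> first | omega | ring
  · intro i j h
    have h3 := hlam j.castSucc_lt_succ
    by_contra hc
    apply h
    simp only [Matrix.of_apply, hWt]
    split_ifs <;> first | omega | ring

lemma det_hWt_minus {n : ℕ} (lam : Fin (n + 1) → ℕ) (hlam : StrictAnti lam)
    (mu : Fin n → ℕ) (hmu : StrictAnti mu) (t : S) :
    (Interlaces lam mu → (Matrix.of (Fin.cons (fun _ => 1 + t)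
        (fun i j => hWt t (mu i) (lam j)) : Fin (n + 1) → Fin (n + 1) → S)).det
      = t ^ lStat lam mu * (1 + t) ^ (sStat lam mu - rStat lam mu + 1)) ∧
    (¬ Interlaces lam mu → (Matrix.of (Fin.cons (fun _ => 1 + t)
        (fun i j => hWt t (mu i) (lam j)) : Fin (n + 1) → Fin (n + 1) → S)).det = 0) := by
  rw [det_const_row, det_eq_prod_diag_of_interlacing lam hlam mu hmu]
  · constructor
    · intro h
      -- The difference is `(1 + t) - 1 = t` if `μ_i = λ_i`, `1 - 0` if `μ_i = λ_{i+1}`, and `(1 +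
      -- t) - 0` strictly in between.
      have key : ∀ i : Fin n, hWt t (mu i) (lam i.succ) - hWt t (mu i) (lam i.castSucc)
          = (if mu i = lam i.castSucc then t else 1)
            * (if mu i < lam i.castSucc ∧ mu i ≠ lam i.succ then 1 + t else 1) := by
        intro i
        obtain ⟨h1, h2⟩ := h i
        have h3 := hlam i.castSucc_lt_succ
        simp only [hWt]
        rcases h1.eq_or_lt with h1 | h1 <;> rcases h2.eq_or_lt with h2 | h2
        · omega
        · simp [h1, not_lt.mpr h3.le, h3.ne']
        · rw [← h2] at h1
          simp [← h2, h1, h1.ne]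
        · simp [h1, h1.ne, h2.ne', not_lt.mpr h2.le]
      simp only [Matrix.of_apply, key]
      rw [prod_mul_distrib, prod_ite_const, prod_ite_const, ← sStat_sub_rStat hlam, ← lStat]
      ring
    · intro h
      simp only [Interlaces, not_forall] at h
      obtain ⟨i, hi⟩ := h
      rw [prod_eq_zero (mem_univ i), mul_zero]
      have h3 := hlam i.castSucc_lt_succ
      simp only [Matrix.of_apply, hWt]
      split_ifs <;> first | omega | ring
  · intro i j h
    have h3 := hlam j.castSucc_lt_succ
    by_contra hc
    apply h
    simp only [Matrix.of_apply, hWt]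
    split_ifs <;> first | omega | ring

end Determinant

/-! ### The scalar series of the conjugation and their recursions -/

section Coefficients

variable {R : Type*} [CommRing R]

/-- The coefficients of `(1 + t x X) / (1 - x X)`. -/
def hCoeff (x t : R) (p : ℕ) : R := hWt t p 0 * x ^ p

/-- The coefficients of `(1 - x X) / (1 + t x X)`. -/
def gCoeff (x t : R) : ℕ → R
  | 0 => 1
  | p + 1 => -(1 + t) * (-t) ^ p * x ^ (p + 1)

lemma hCoeff_zero (x t : R) : hCoeff x t 0 = 1 := by simp [hCoeff, hWt]

lemma hCoeff_succ (x t : R) (p : ℕ) : hCoeff x t (p + 1) = (1 + t) * x ^ (p + 1) := by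
  rw [hCoeff, hWt_of_lt p.succ_pos]

lemma sum_one_sub_pow (t : R) (M : ℕ) :
    ∑ i ∈ range M, (1 + t) * (1 - (-t) ^ (i + 1)) = (1 + t) * M + t + (-t) ^ (M + 1) := by
  induction M with
  | zero => simp
  | succ M ih => rw [sum_range_succ, ih]; push_cast; ring

/-- Logarithmic derivative: `X h'/h = ∑ (1 - (-t)^q) x^q X^q` for `h = (1 + txX)/(1 - xX)`. The
series `1/h` obeys the same recursion with the opposite sign, which is `gCoeff_rec`. -/
lemma hCoeff_rec (x t : R) (N : ℕ) : (N : R) * hCoeff x t N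
    = ∑ i ∈ range N, (1 - (-t) ^ (i + 1)) * x ^ (i + 1) * hCoeff x t (N - (i + 1)) := by
  rcases N with _ | N
  · simp
  · have : ∀ i ∈ range N, (1 - (-t) ^ (i + 1)) * x ^ (i + 1) * hCoeff x t (N + 1 - (i + 1))
        = (1 + t) * (1 - (-t) ^ (i + 1)) * x ^ (N + 1) := by
      intro i hi
      rw [Finset.mem_range] at hi
      obtain ⟨k, rfl⟩ := Nat.exists_eq_add_of_lt hi
      rw [show i + k + 1 + 1 - (i + 1) = k + 1 by omega, hCoeff_succ]
      ring
    rw [sum_range_succ, sum_congr rfl this, ← sum_mul, sum_one_sub_pow, Nat.sub_self, hCoeff_zero,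
      hCoeff_succ]
    push_cast
    ring

lemma sum_pow_sub_pow (t : R) (M : ℕ) :
    ∑ i ∈ range M, (1 + t) * ((-t) ^ (M - (i + 1)) - (-t) ^ M)
      = 1 - (-t) ^ M - (1 + t) * M * (-t) ^ M := by
  have hr := sum_range_reflect (fun i => (1 + t) * ((-t) ^ i - (-t) ^ M)) M
  simp only [Nat.sub_sub, add_comm 1] at hr
  rw [hr]
  simp only [mul_sub, sum_sub_distrib, sum_const, card_range, nsmul_eq_mul]
  have := mul_neg_geom_sum (-t) M
  rw [sub_neg_eq_add] at this
  rw [← mul_sum, this]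
  ring

lemma gCoeff_rec (x t : R) (N : ℕ) : (N : R) * gCoeff x t N
    = ∑ i ∈ range N, -((1 - (-t) ^ (i + 1)) * x ^ (i + 1)) * gCoeff x t (N - (i + 1)) := by
  rcases N with _ | N
  · simp
  · have : ∀ i ∈ range N, -((1 - (-t) ^ (i + 1)) * x ^ (i + 1)) * gCoeff x t (N + 1 - (i + 1))
        = (1 + t) * ((-t) ^ (N - (i + 1)) - (-t) ^ N) * x ^ (N + 1) := by
      intro i hi
      rw [Finset.mem_range] at hi
      obtain ⟨k, rfl⟩ := Nat.exists_eq_add_of_lt hi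
      rw [show i + k + 1 + 1 - (i + 1) = k + 1 by omega,
        show i + k + 1 - (i + 1) = k by omega, gCoeff]
      ring
    rw [sum_range_succ, sum_congr rfl this, ← sum_mul, sum_pow_sub_pow, Nat.sub_self]
    simp only [gCoeff]
    push_cast
    ring

/-- The convolution of the two sequences of coefficients, without the term of index zero. -/
lemma sum_gCoeff_mul_hCoeff (x t : R) (N : ℕ) :
    ∑ p ∈ range (N + 1), gCoeff x t (p + 1) * hCoeff x t (N - p) = -(1 + t) * x ^ (N + 1) := by
  have key : ∀ M, ∑ p ∈ range M, (1 + t) * (-t) ^ p = 1 - (-t) ^ M := fun M => by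
    rw [← mul_sum, ← mul_neg_geom_sum, sub_neg_eq_add]
  have : ∀ p ∈ range N, gCoeff x t (p + 1) * hCoeff x t (N - p)
      = -((1 + t) * (-t) ^ p) * ((1 + t) * x ^ (N + 1)) := by
    intro p hp
    rw [Finset.mem_range] at hp
    obtain ⟨k, rfl⟩ := Nat.exists_eq_add_of_lt hp
    rw [show p + k + 1 - p = k + 1 by omega, hCoeff_succ, gCoeff]
    ring
  -- The last term is separate because `hCoeff` is `1`, not `1 + t`, at index `0`. The total is
  -- minus `hCoeff` at `N + 1`, as the two series are inverse to each other.
  rw [sum_range_succ, sum_congr rfl this, ← sum_mul, sum_neg_distrib, key, Nat.sub_self,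
    hCoeff_zero, gCoeff]
  ring

end Coefficients

/-! ### Commutation relations of the `J_n` and their action on the vacua -/

section FockOperators

open CliffordAlgebra

variable (R : Type*) [CommRing R]

lemma nord_mul_psiStar (i k j : ℤ) :
    nord R i k * psiStar R j = psiStar R j * nord R i k + if k = j then psiStar R i else 0 := by
  have h1 := eq_sub_of_add_eq (psi_psiStar_anticomm R k j)
  have h2 := eq_neg_of_add_eq_zero_left (psiStar_anticomm R i j)
  unfold nord
  by_cases hi : 1 ≤ i
  · simp only [if_pos hi]
    rw [mul_assoc, h1, mul_sub, ← mul_assoc, h2]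
    split_ifs <;> noncomm_ring
  · simp only [if_neg hi]
    rw [neg_mul, mul_assoc, h2, mul_neg, ← mul_assoc, h1]
    split_ifs <;> noncomm_ring

lemma nord_mul_psi (i k j : ℤ) :
    nord R i k * psi R j = psi R j * nord R i k - if i = j then psi R k else 0 := by
  have h1 := eq_sub_of_add_eq' (psi_psiStar_anticomm R j i)
  have h2 := eq_neg_of_add_eq_zero_left (psi_anticomm R k j)
  simp only [eq_comm (a := j)] at h1
  unfold nord
  by_cases hi : 1 ≤ i
  · simp only [if_pos hi]
    rw [mul_assoc, h2, mul_neg, ← mul_assoc, h1]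
    split_ifs <;> noncomm_ring
  · simp only [if_neg hi]
    rw [neg_mul, mul_assoc, h1, mul_sub, ← mul_assoc, h2]
    split_ifs <;> noncomm_ring

lemma J_apply (n : ℤ) (v : Fock R) : J R n v = ∑ᶠ k : ℤ, nord R (k - n) k • v := rfl

lemma support_ite_finite {M : Type*} [Zero M] (j : ℤ) (f : ℤ → M) :
    (Function.support fun k => if k = j then f k else 0).Finite :=
  (Set.finite_singleton j).subset fun k hk => by
    by_contra h
    exact hk (if_neg h)

lemma finsum_ite_eq' {M : Type*} [AddCommMonoid M] (j : ℤ) (f : ℤ → M) :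
    (∑ᶠ k, if k = j then f k else 0) = f j := by
  rw [finsum_eq_single _ j fun k hk => if_neg hk, if_pos rfl]

lemma smul_J_support_finite (n : ℤ) (a : A R) (v : Fock R) :
    (Function.support fun k : ℤ => a • nord R (k - n) k • v).Finite :=
  (J_support_finite R n v).subset fun k hk h0 => hk (by simp only [h0, smul_zero])

/-- `[J_n, ψ*_j] = ψ*_{j-n}`. -/
lemma J_psiStar_smul (n j : ℤ) (v : Fock R) :
    J R n (psiStar R j • v) = psiStar R j • J R n v + psiStar R (j - n) • v := by
  rw [J_apply, J_apply, smul_finsum' _ (J_support_finite R n v),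
    ← finsum_ite_eq' j (fun k => psiStar R (k - n) • v),
    ← finsum_add_distrib (smul_J_support_finite R n _ v) (support_ite_finite j _)]
  refine finsum_congr fun k => ?_
  rw [smul_smul, nord_mul_psiStar, add_smul, mul_smul, ite_smul, zero_smul]

/-- `[J_n, ψ_j] = -ψ_{j+n}`. -/
lemma J_psi_smul (n j : ℤ) (v : Fock R) :
    J R n (psi R j • v) = psi R j • J R n v - psi R (j + n) • v := by
  rw [J_apply, J_apply, smul_finsum' _ (J_support_finite R n v),
    ← finsum_ite_eq' (j + n) (fun k => psi R k • v),
    ← finsum_sub_distrib (smul_J_support_finite R n _ v) (support_ite_finite (j + n) _)]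
  refine finsum_congr fun k => ?_
  rw [smul_smul, nord_mul_psi, sub_smul, mul_smul, ite_smul, zero_smul]
  simp only [sub_eq_iff_eq_add]

lemma J_nord_smul (n i j : ℤ) (v : Fock R) :
    J R n (nord R i j • v) = nord R i j • J R n v
      + (psiStar R (i - n) * psi R j - psiStar R i * psi R (j + n)) • v := by
  have e1 := eq_sub_of_add_eq' (psi_psiStar_anticomm R j (i - n))
  have e2 := eq_sub_of_add_eq' (psi_psiStar_anticomm R (j + n) i)
  have e3 : (if j = i - n then (1 : A R) else 0) = if j + n = i then 1 else 0 := by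
    simp only [eq_sub_iff_add_eq]
  unfold nord
  split_ifs
  · simp only [mul_smul, J_psi_smul, J_psiStar_smul, sub_smul, smul_sub]
    abel
  -- Reordering produces two central constants; they are equal, hence cancel.
  · rw [e1, e2, e3]
    simp only [neg_smul, map_neg, mul_smul, J_psi_smul, J_psiStar_smul, sub_smul, smul_add]
    abel

lemma nord_of_ne {i j : ℤ} (h : i ≠ j) : nord R i j = psiStar R i * psi R j := by
  have := psi_psiStar_anticomm R j i
  rw [if_neg h.symm] at this
  unfold nord
  split_ifs
  · rfl
  · rw [eq_neg_of_add_eq_zero_left this, neg_neg]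

/-- The commutator is the sum defining `J_{p+q}` minus the same sum with its index shifted by `p`.
For `p + q ≠ 0` normal ordering is the plain product, and both sums are finite on each vector, so
they cancel. -/
lemma commute_J {p q : ℤ} (h : p + q ≠ 0) : Commute (J R p) (J R q) := by
  refine LinearMap.ext fun v => ?_
  rw [Module.End.mul_apply, Module.End.mul_apply, J_apply R q v, J_apply R q (J R p v),
    map_finsum _ (J_support_finite R q v)]
  have e : ∀ k : ℤ, J R p (nord R (k - q) k • v) = nord R (k - q) k • J R p v
      + (nord R (k - (p + q)) k • v - nord R (k + p - (p + q)) (k + p) • v) := by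
    intro k
    rw [J_nord_smul, nord_of_ne R (show k - (p + q) ≠ k by omega),
      nord_of_ne R (show k + p - (p + q) ≠ k + p by omega), sub_smul, ← sub_sub, sub_right_comm,
      show k + p - (p + q) = k - q by ring]
  have f1 := J_support_finite R (p + q) v
  have f2 : (Function.support fun k : ℤ => nord R (k + p - (p + q)) (k + p) • v).Finite :=
    f1.preimage (f := fun k : ℤ => k + p) (add_left_injective p).injOn
  rw [finsum_congr e, finsum_add_distrib (J_support_finite R q _)
    ((f1.union f2).subset (Function.support_sub _ _)), finsum_sub_distrib f1 f2]
  have := finsum_comp_equiv (Equiv.addRight p) (f := fun k : ℤ => nord R (k - (p + q)) k • v)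
  simp only [Equiv.coe_addRight] at this
  rw [this, sub_self, add_zero]

lemma annGen_smul_vac {c : A R} (hc : c ∈ annGen R) : c • vac R = 0 := by
  rw [vac, ← Submodule.Quotient.mk_smul, Submodule.Quotient.mk_eq_zero, smul_eq_mul, mul_one]
  exact Submodule.subset_span hc

lemma pairing_vacBra_crGen_smul {c : A R} (hc : c ∈ crGen R) (v : Fock R) :
    pairing R (vacBra R) (c • v) = 0 := by
  obtain ⟨b, rfl⟩ := Submodule.Quotient.mk_surjective _ v
  rw [vacBra, ← Submodule.Quotient.mk_smul, pairing_mk, one_mul]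
  exact vev_crGen_mul R hc b

lemma J_vac {n : ℤ} (hn : 0 < n) : J R n (vac R) = 0 := by
  rw [J_apply, ← finsum_zero (α := ℤ)]
  refine finsum_congr fun k => ?_
  unfold nord
  split_ifs
  · rw [mul_smul, annGen_smul_vac R ⟨k, Or.inr ⟨by omega, rfl⟩⟩, smul_zero]
  · rw [neg_smul, mul_smul, annGen_smul_vac R ⟨k - n, Or.inl ⟨by omega, rfl⟩⟩, smul_zero, neg_zero]

lemma pairing_vacBra_J {n : ℤ} (hn : n < 0) (v : Fock R) :
    pairing R (vacBra R) (J R n v) = 0 := by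
  rw [J_apply, map_finsum _ (J_support_finite R n v), ← finsum_zero (α := ℤ)]
  refine finsum_congr fun k => ?_
  unfold nord
  split_ifs
  · rw [mul_smul, pairing_vacBra_crGen_smul R ⟨k - n, Or.inl ⟨by omega, rfl⟩⟩]
  · rw [neg_smul, map_neg, mul_smul, pairing_vacBra_crGen_smul R ⟨k, Or.inr ⟨by omega, rfl⟩⟩,
      neg_zero]

end FockOperators

/-! ### Conjugating fermions by the exponential -/

section ExpOperators

open CliffordAlgebra

variable {R : Type*} [CommRing R] [Algebra ℚ R]

/-- The lists in the definition are grouped by their sum and then by their length. Finiteness of the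
support allows a cutoff in the degree, and any larger cutoff gives the same value. -/
lemma braExpKet_eq_sum (m : FockDual R) (H : ℕ+ → Module.End R (Fock R)) (v : Fock R)
    (hfin : (Function.support fun L : List ℕ+ => (1 / (L.length.factorial : ℚ)) •
      pairing R m ((L.map H).prod v)).Finite) :
    ∃ M₀ : ℕ, ∀ M ≥ M₀, braExpKet R m H v
      = ∑ N ∈ range M, pairing R m (expCoeff R H N v) := by
  refine ⟨(hfin.toFinset.sup fun L => (L.map fun q : ℕ+ => (q : ℕ)).sum) + 1, fun M hM => ?_⟩
  have hlen : ∀ L : List ℕ+, L.length ≤ (L.map fun q : ℕ+ => (q : ℕ)).sum := by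
    intro L
    induction L with
    | nil => simp
    | cons q L ih =>
      have := q.pos
      simp only [List.length_cons, List.map_cons, List.sum_cons]
      omega
  rw [braExpKet, finsum_eq_sum_of_support_subset
    (s := (range M).biUnion fun N => (range (N + 1)).biUnion fun k => listsOf k N),
    sum_biUnion]
  · refine sum_congr rfl fun N _ => ?_
    rw [sum_biUnion]
    · rw [expCoeff, LinearMap.sum_apply, map_sum]
      refine sum_congr rfl fun k _ => ?_
      rw [coeff_seriesOf_pow, LinearMap.smul_apply, map_smul, LinearMap.sum_apply, map_sum,
        smul_sum]
      refine sum_congr rfl fun L hL => ?_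
      rw [(mem_listsOf.mp hL).1, algebraMap_smul]
    · intro k _ k' _ hk
      rw [Function.onFun, disjoint_left]
      intro L h1 h2
      exact hk ((mem_listsOf.mp h1).1.symm.trans (mem_listsOf.mp h2).1)
  · intro N _ N' _ hN
    rw [Function.onFun, disjoint_left]
    intro L h1 h2
    simp only [mem_biUnion, mem_listsOf] at h1 h2
    obtain ⟨_, _, _, h1⟩ := h1
    obtain ⟨_, _, _, h2⟩ := h2
    exact hN (h1.symm.trans h2)
  · intro L hL
    have := le_sup (f := fun L : List ℕ+ => (L.map fun q : ℕ+ => (q : ℕ)).sum)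
      (hfin.mem_toFinset.mpr hL)
    have := hlen L
    simp only [coe_biUnion, Set.mem_iUnion, coe_range, Set.mem_Iio, mem_coe, mem_listsOf]
    exact ⟨_, by omega, _, by omega, rfl, rfl⟩

/-- `f` is the conjugate of `a` by the exponential of `∑ H_q`:  `e^H a = f e^H`. -/
def IsExpConj (H : ℕ+ → Module.End R (Fock R)) (a : A R) (f : (A R)⟦X⟧) : Prop :=
  ∀ N v, expCoeff R H N (a • v)
    = ∑ p ∈ HasAntidiagonal.antidiagonal N, coeff p.1 f • expCoeff R H p.2 v

/-- `f` is the conjugate of `a` by the inverse of the exponential of `∑ H_q`:  `a e^H = e^H f`. -/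
def IsInvConj (H : ℕ+ → Module.End R (Fock R)) (a : A R) (f : (A R)⟦X⟧) : Prop :=
  ∀ N v, a • expCoeff R H N v
    = ∑ p ∈ HasAntidiagonal.antidiagonal N, expCoeff R H p.2 (coeff p.1 f • v)

variable {H : ℕ+ → Module.End R (Fock R)}

lemma sum_antidiagonal_coeff_one {B M : Type*} [Ring B] [AddCommGroup M] [Module B M] (N : ℕ)
    (f : B → ℕ → M) (hf : ∀ n, f 0 n = 0) :
    ∑ p ∈ HasAntidiagonal.antidiagonal N, f (coeff p.1 (1 : B⟦X⟧)) p.2 = f 1 N := by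
  rw [sum_eq_single (0, N)]
  · simp
  · rintro ⟨a, b⟩ hp hne
    rw [HasAntidiagonal.mem_antidiagonal] at hp
    have : a ≠ 0 := fun h => hne (by ext <;> simp_all)
    rw [coeff_one, if_neg this, hf]
  · simp

lemma IsExpConj.one : IsExpConj H 1 1 := by
  intro N v
  rw [sum_antidiagonal_coeff_one (M := Fock R) N (fun c n => c • expCoeff R H n v)
    fun _ => zero_smul _ _, one_smul, one_smul]

lemma IsInvConj.one : IsInvConj H 1 1 := by
  intro N v
  rw [sum_antidiagonal_coeff_one (M := Fock R) N (fun c n => expCoeff R H n (c • v))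
    fun _ => by rw [zero_smul, map_zero], one_smul, one_smul]

lemma IsExpConj.mul {a b : A R} {f g : (A R)⟦X⟧} (hf : IsExpConj H a f) (hg : IsExpConj H b g) :
    IsExpConj H (a * b) (f * g) := by
  intro N v
  rw [mul_smul, hf]
  simp only [hg _ v, smul_sum, smul_smul]
  rw [sum_antidiagonal_assoc fun i j k => (coeff i f * coeff j g) • expCoeff R H k v]
  exact sum_congr rfl fun p _ => by rw [coeff_mul, sum_smul]

lemma IsInvConj.mul {a b : A R} {f g : (A R)⟦X⟧} (hf : IsInvConj H a f) (hg : IsInvConj H b g) :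
    IsInvConj H (a * b) (f * g) := by
  intro N v
  rw [mul_smul, hg, smul_sum]
  simp only [hf _ _, smul_smul]
  rw [sum_antidiagonal_swap_right fun i j k => expCoeff R H k ((coeff j f * coeff i g) • v),
    sum_antidiagonal_assoc fun i j k => expCoeff R H k ((coeff i f * coeff j g) • v)]
  exact sum_congr rfl fun p _ => by rw [coeff_mul, sum_smul, map_sum]

lemma IsExpConj.prod_ofFn {m : ℕ} {a : Fin m → A R} {f : Fin m → (A R)⟦X⟧}
    (h : ∀ i, IsExpConj H (a i) (f i)) : IsExpConj H (List.ofFn a).prod (List.ofFn f).prod := by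
  induction m with
  | zero => simpa using IsExpConj.one
  | succ m ih =>
    rw [List.ofFn_succ, List.ofFn_succ, List.prod_cons, List.prod_cons]
    exact (h 0).mul (ih fun i => h i.succ)

lemma IsInvConj.prod_reverse_ofFn {m : ℕ} {a : Fin m → A R} {f : Fin m → (A R)⟦X⟧}
    (h : ∀ i, IsInvConj H (a i) (f i)) :
    IsInvConj H (List.ofFn a).reverse.prod (List.ofFn f).reverse.prod := by
  induction m with
  | zero => simpa using IsInvConj.one
  | succ m ih =>
    simp only [List.ofFn_succ, List.reverse_cons, List.prod_append, List.prod_singleton]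
    exact (ih fun i => h i.succ).mul (h 0)

/-- By the recursion every term of positive degree has a factor `H`, which can be moved to the
right, next to `v`. -/
lemma expCoeff_apply_of_kill (hH : ∀ p q, Commute (H p) (H q)) {v : Fock R}
    (hv : ∀ q, H q v = 0) {N : ℕ} (hN : N ≠ 0) : expCoeff R H N v = 0 := by
  refine eq_of_nsmul_eq R hN ?_
  rw [← LinearMap.smul_apply, nsmul_expCoeff R hH, LinearMap.sum_apply, smul_zero]
  refine sum_eq_zero fun i _ => ?_
  rw [(commute_expCoeff R hH _ _).eq, LinearMap.smul_apply, Module.End.mul_apply, hv, map_zero,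
    smul_zero]

lemma map_expCoeff_of_kill (hH : ∀ p q, Commute (H p) (H q)) {ℓ : Fock R →ₗ[R] R}
    (hℓ : ∀ q v, ℓ (H q v) = 0) {N : ℕ} (hN : N ≠ 0) (v : Fock R) :
    ℓ (expCoeff R H N v) = 0 := by
  refine eq_of_nsmul_eq R hN ?_
  rw [← map_nsmul, ← LinearMap.smul_apply, nsmul_expCoeff R hH, LinearMap.sum_apply, map_sum,
    smul_zero]
  refine sum_eq_zero fun i _ => ?_
  rw [LinearMap.smul_apply, Module.End.mul_apply, map_nsmul, hℓ, smul_zero]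

lemma IsExpConj.expCoeff_apply (hH : ∀ p q, Commute (H p) (H q)) {v : Fock R}
    (hv : ∀ q, H q v = 0) {a : A R} {f : (A R)⟦X⟧} (h : IsExpConj H a f) (N : ℕ) :
    expCoeff R H N (a • v) = coeff N f • v := by
  rw [h, sum_eq_single (N, 0)]
  · rw [expCoeff_zero, Module.End.one_apply]
  · rintro ⟨i, j⟩ hp hne
    rw [HasAntidiagonal.mem_antidiagonal] at hp
    rw [expCoeff_apply_of_kill hH hv (fun h => hne (by ext <;> simp_all)), smul_zero]
  · simp

lemma IsInvConj.map_expCoeff (hH : ∀ p q, Commute (H p) (H q)) {ℓ : Fock R →ₗ[R] R}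
    (hℓ : ∀ q v, ℓ (H q v) = 0) {a : A R} {f : (A R)⟦X⟧} (h : IsInvConj H a f) (N : ℕ)
    (v : Fock R) : ℓ (a • expCoeff R H N v) = ℓ (coeff N f • v) := by
  rw [h, map_sum, sum_eq_single (N, 0)]
  · rw [expCoeff_zero, Module.End.one_apply]
  · rintro ⟨i, j⟩ hp hne
    rw [HasAntidiagonal.mem_antidiagonal] at hp
    exact map_expCoeff_of_kill hH hℓ (fun h => hne (by ext <;> simp_all)) _
  · simp

lemma isExpConj_mk (hH : ∀ p q, Commute (H p) (H q)) (c : ℕ+ → R) (h : ℕ → R) (h0 : h 0 = 1)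
    (hh : ∀ N : ℕ, (N : R) * h N
      = ∑ i ∈ range N, ((i : R) + 1) * (c i.succPNat * h (N - (i + 1))))
    (w : ℕ → A R)
    (hw : ∀ (q : ℕ+) p v, H q (w p • v) = w p • H q v + c q • w (p + q) • v) :
    IsExpConj H (w 0) (PowerSeries.mk fun p => h p • w p) := by
  intro N v
  have := exp_intertwine R (expCoeff_zero R H) (nsmul_expCoeff R hH) c h h0 hh
    (fun p => Algebra.lsmul R R (Fock R) (w p)) (fun q p => LinearMap.ext fun v => by simpa using hw q p v) N
  simpa [LinearMap.sum_apply] using LinearMap.congr_fun this v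

lemma isInvConj_mk (hH : ∀ p q, Commute (H p) (H q)) (c : ℕ+ → R) (h : ℕ → R) (h0 : h 0 = 1)
    (hh : ∀ N : ℕ, (N : R) * h N
      = ∑ i ∈ range N, ((i : R) + 1) * (c i.succPNat * h (N - (i + 1))))
    (w : ℕ → A R)
    (hw : ∀ (q : ℕ+) p v, H q (w p • v) = w p • H q v - c q • w (p + q) • v) :
    IsInvConj H (w 0) (PowerSeries.mk fun p => h p • w p) := by
  intro N v
  -- Pulling `w 0` through the exponential from the left is the same statement in the opposite
  -- algebra, where the commutator changes sign. The recursion keeps its form there because each `H`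
  -- commutes with the exponential.
  have := exp_intertwine R (B := (Module.End R (Fock R))ᵐᵒᵖ)
    (H := fun q => MulOpposite.op (H q)) (E := fun N => MulOpposite.op (expCoeff R H N))
    (congrArg MulOpposite.op (expCoeff_zero R H))
    (fun N => by
      apply MulOpposite.unop_injective
      simp only [MulOpposite.unop_smul, MulOpposite.unop_op, Finset.unop_sum,
        MulOpposite.unop_mul]
      rw [nsmul_expCoeff R hH]
      exact sum_congr rfl fun i _ => by rw [(commute_expCoeff R hH _ _).eq])
    c h h0 hh
    (fun p => MulOpposite.op (Algebra.lsmul R R (Fock R) (w p)))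
    (fun q p => MulOpposite.unop_injective (LinearMap.ext fun v => by
      have := hw q p v
      rw [eq_sub_iff_add_eq] at this
      exact this.symm)) N
  have := LinearMap.congr_fun (congrArg MulOpposite.unop this) v
  simp only [coeff_mk, smul_assoc, map_smul]
  simpa [LinearMap.sum_apply, Finset.unop_sum] using this

end ExpOperators

/-! ### Vacuum expectation values of power series and the contractions -/

section Matrix

open CliffordAlgebra

variable (R : Type*) [CommRing R]

/-- The vacuum expectation value, coefficientwise. -/
noncomputable def vevSeries : (A R)⟦X⟧ →+ R⟦X⟧ where
  toFun f := PowerSeries.mk fun n => vev R (coeff n f)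
  map_zero' := by ext; simp
  map_add' f g := by ext; simp

lemma coeff_vevSeries (f : (A R)⟦X⟧) (n : ℕ) : coeff n (vevSeries R f) = vev R (coeff n f) := by
  simp [vevSeries]

lemma vevSeries_one : vevSeries R 1 = 1 := by
  ext n
  rw [coeff_vevSeries, coeff_one, coeff_one]
  split_ifs
  · exact vev_one R
  · exact map_zero _

/-- Scalar power series as power series over the Clifford algebra. -/
noncomputable abbrev scalarSeries : R⟦X⟧ →+* (A R)⟦X⟧ := PowerSeries.map (algebraMap R (A R))

lemma scalarSeries_commute (s : R⟦X⟧) (f : (A R)⟦X⟧) : Commute (scalarSeries R s) f := by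
  ext n
  rw [coeff_mul, coeff_mul, ← Nat.sum_antidiagonal_swap]
  exact sum_congr rfl fun p _ => by simpa using Algebra.commutes _ _

lemma vevSeries_scalarSeries_mul (s : R⟦X⟧) (f : (A R)⟦X⟧) :
    vevSeries R (scalarSeries R s * f) = s * vevSeries R f := by
  ext n
  rw [coeff_vevSeries, coeff_mul, coeff_mul, map_sum]
  exact sum_congr rfl fun p _ => by
    rw [coeff_map, ← Algebra.smul_def, map_smul, coeff_vevSeries, smul_eq_mul]

lemma vevSeries_mul_eq_zero {f g : (A R)⟦X⟧}
    (h : ∀ i j, vev R (coeff i f * coeff j g) = 0) : vevSeries R (f * g) = 0 := by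
  ext n
  rw [coeff_vevSeries, coeff_mul, map_sum, map_zero]
  exact sum_eq_zero fun p _ => h _ _

variable {R}

/-- A contraction of a fixed fermion with a conjugated one is a monomial: only the mode with
matching index survives. This gives the entry in the shape required by `det_mul_pow`; for `a < b`
the weight `hWt` makes the truncated exponent harmless. -/
lemma coeff_C_hWt_mul (t x : R) (a b N : ℕ) :
    coeff N (hWt (C t) a b * (C x * X) ^ (a - b)) = if (b : ℤ) = a - N then hCoeff x t N else 0 := by
  have e : hWt (C t : R⟦X⟧) a b = C (hWt t a b) := by
    unfold hWt
    split_ifs <;> simp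
  rw [e, mul_pow, ← map_pow, ← mul_assoc, ← map_mul, coeff_C_mul_X_pow]
  by_cases hab : b ≤ a
  · have h1 : N = a - b ↔ (b : ℤ) = a - N := by omega
    simp only [h1]
    split_ifs with h
    · have h2 : a = N + b := by omega
      subst h2
      simp [hCoeff, hWt]
    · rfl
  · rw [if_neg (show ¬ (b : ℤ) = a - N by omega)]
    simp [hWt, show a < b by omega]

lemma psi_series_anticomm_psiStar (h : ℕ → R) (b : ℤ) (w : ℤ) :
    C (psi R b) * (PowerSeries.mk fun p : ℕ => h p • psiStar R (w - p))
      + (PowerSeries.mk fun p : ℕ => h p • psiStar R (w - p)) * C (psi R b)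
      = scalarSeries R (PowerSeries.mk fun N : ℕ => if b = w - N then h N else 0) := by
  ext N
  rw [map_add, coeff_C_mul, coeff_mul_C, coeff_map, coeff_mk, coeff_mk, mul_smul_comm,
    smul_mul_assoc, ← smul_add, psi_psiStar_anticomm]
  split_ifs <;> simp [Algebra.algebraMap_eq_smul_one]

lemma psiStar_series_anticomm_psi (h : ℕ → R) (a : ℤ) (w : ℤ) :
    (PowerSeries.mk fun p : ℕ => h p • psi R (w - p)) * C (psiStar R a)
      + C (psiStar R a) * (PowerSeries.mk fun p : ℕ => h p • psi R (w - p))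
      = scalarSeries R (PowerSeries.mk fun N : ℕ => if a = w - N then h N else 0) := by
  ext N
  rw [map_add, coeff_C_mul, coeff_mul_C, coeff_map, coeff_mk, coeff_mk, mul_smul_comm,
    smul_mul_assoc, ← smul_add, psi_psiStar_anticomm]
  simp only [eq_comm (a := a)]
  split_ifs <;> simp [Algebra.algebraMap_eq_smul_one]

/-- The annihilation part of the conjugate of `ψ_{-1/2}`. -/
noncomputable def psiAnnSeries (g : ℕ → R) : (A R)⟦X⟧ :=
  PowerSeries.mk fun p : ℕ => if p = 0 then 0 else g p • psi R p

lemma psiAnnSeries_anticomm (x t : R) {a : ℕ} (ha : 0 < a) :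
    psiAnnSeries (gCoeff x t) * (PowerSeries.mk fun p : ℕ => hCoeff x t p • psiStar R (a - p))
      + (PowerSeries.mk fun p : ℕ => hCoeff x t p • psiStar R (a - p))
        * psiAnnSeries (gCoeff x t)
      = scalarSeries R (-(1 + C t) * (C x * X) ^ a) := by
  have e : (-(1 + C t) * (C x * X) ^ a : R⟦X⟧) = C (-(1 + t) * x ^ a) * X ^ a := by
    rw [mul_pow]
    simp [mul_assoc]
  ext N
  rw [e, map_add, coeff_mul, coeff_mul, ← Nat.sum_antidiagonal_swap (n := N) (f := fun p =>
    coeff p.1 (PowerSeries.mk fun p : ℕ => hCoeff x t p • psiStar R (a - p)) * _),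
    ← sum_add_distrib, coeff_map, coeff_C_mul_X_pow]
  -- The modes `ψ_i` and `ψ*_{a-j}` contract only if `i + j = a`, so the whole anticommutator sits
  -- in degree `a`. Its value is the convolution of `1/h` and `h` without the term `i = 0`.
  have key : ∀ p ∈ HasAntidiagonal.antidiagonal N,
      coeff p.1 (psiAnnSeries (gCoeff x t))
        * coeff p.2 (PowerSeries.mk fun p : ℕ => hCoeff x t p • psiStar R (a - p))
      + coeff p.swap.1 (PowerSeries.mk fun p : ℕ => hCoeff x t p • psiStar R (a - p))
        * coeff p.swap.2 (psiAnnSeries (gCoeff x t))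
      = algebraMap R (A R) (if N = a then
          (if p.1 = 0 then 0 else gCoeff x t p.1) * hCoeff x t p.2 else 0) := by
    rintro ⟨i, j⟩ hp
    rw [HasAntidiagonal.mem_antidiagonal] at hp
    simp only at hp
    simp only [psiAnnSeries, coeff_mk, Prod.swap_prod_mk]
    by_cases hi : i = 0
    · simp [hi]
    · simp only [if_neg hi]
      rw [smul_mul_smul_comm, smul_mul_smul_comm, mul_comm (hCoeff x t j), ← smul_add,
        psi_psiStar_anticomm]
      have : (i : ℤ) = a - j ↔ N = a := by omega
      simp only [this]
      split_ifs <;> simp [Algebra.algebraMap_eq_smul_one]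
  rw [sum_congr rfl key, ← map_sum]
  congr 1
  split_ifs with hN
  · subst hN
    obtain ⟨N, rfl⟩ := Nat.exists_eq_succ_of_ne_zero ha.ne'
    rw [Nat.sum_antidiagonal_eq_sum_range_succ
      (fun i j => (if i = 0 then 0 else gCoeff x t i) * hCoeff x t j), sum_range_succ',
      ← sum_gCoeff_mul_hCoeff]
    simp
  · simp

lemma prod_mul_of_anticomm {B : Type*} [Ring B] (c : B) (L : List B)
    (h : ∀ a ∈ L, a * c = -(c * a)) : L.prod * c = (-1) ^ L.length * (c * L.prod) := by
  induction L with
  | nil => simp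
  | cons a L ih =>
    have e : Commute a ((-1 : B) ^ L.length) := (Commute.neg_one_right _).pow_right _
    rw [List.prod_cons, mul_assoc, ih fun b hb => h b (List.mem_cons_of_mem _ hb), ← mul_assoc,
      e.eq, mul_assoc, ← mul_assoc a, h a List.mem_cons_self, List.length_cons, pow_succ]
    noncomm_ring

lemma ket_eq {n : ℕ} (lam : Fin n → ℕ) :
    ket R lam = (List.ofFn fun i => psiStar R (lam i)).prod • vac R := rfl

lemma bra_eq_mk {n : ℕ} (mu : Fin n → ℕ) :
    bra R mu = Submodule.Quotient.mk (List.ofFn fun i => psi R (mu i)).reverse.prod := by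
  rw [bra, vacBra, ← Submodule.Quotient.mk_smul, op_smul_eq_mul, one_mul]

lemma pairing_mk_smul_vac (a b : A R) :
    pairing R (Submodule.Quotient.mk a) (b • vac R) = vev R (a * b) := by
  rw [vac, ← Submodule.Quotient.mk_smul, pairing_mk, smul_eq_mul, mul_one]

lemma C_list_prod {B : Type*} [Ring B] {m : ℕ} (a : Fin m → B) :
    C (List.ofFn a).prod = (List.ofFn fun i => (C (a i) : B⟦X⟧)).prod := by
  rw [map_list_prod, List.map_ofFn]
  rfl

lemma C_list_reverse_prod {B : Type*} [Ring B] {m : ℕ} (a : Fin m → B) :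
    C (List.ofFn a).reverse.prod = (List.ofFn fun i => (C (a i) : B⟦X⟧)).reverse.prod := by
  rw [map_list_prod, List.map_reverse, List.map_ofFn]
  rfl

variable [Algebra ℚ R]

lemma algebraMap_inv_mul (q : ℕ) : algebraMap ℚ R (1 / ((q + 1 : ℕ) : ℚ)) * ((q : R) + 1) = 1 := by
  have : ((q : R) + 1) = algebraMap ℚ R ((q + 1 : ℕ) : ℚ) := by simp
  rw [this, ← map_mul, one_div_mul_cancel (by positivity), map_one]

/-- The coefficients of `φ_±`. -/
noncomputable def phiCoeff (x t : R) (q : ℕ+) : R :=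
  (1 / (q : ℚ)) • ((1 - (-t) ^ (q : ℕ)) * x ^ (q : ℕ))

lemma succ_mul_phiCoeff (x t : R) (i : ℕ) (r : R) :
    ((i : R) + 1) * (phiCoeff x t i.succPNat * r) = (1 - (-t) ^ (i + 1)) * x ^ (i + 1) * r := by
  have := algebraMap_inv_mul (R := R) i
  rw [phiCoeff, Nat.succPNat_coe, Nat.succ_eq_add_one, Algebra.smul_def]
  linear_combination ((1 - (-t) ^ (i + 1)) * x ^ (i + 1) * r) * this

/-- The operators `phiCoeff x t q • J_{ε q}`. -/
noncomputable def phiOp (x t : R) (ε : ℤ) (q : ℕ+) : Module.End R (Fock R) :=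
  phiCoeff x t q • J R (ε * q)

lemma commute_phiOp (x t : R) {ε : ℤ} (hε : ε ≠ 0) (p q : ℕ+) :
    Commute (phiOp x t ε p) (phiOp x t ε q) := by
  have hne : ε * (p : ℕ) + ε * (q : ℕ) ≠ 0 := by
    rw [← mul_add]
    have := p.pos
    exact mul_ne_zero hε (by positivity)
  refine LinearMap.ext fun v => ?_
  have := LinearMap.congr_fun (commute_J R hne).eq v
  simp only [Module.End.mul_apply] at this
  simp only [phiOp, Module.End.mul_apply, LinearMap.smul_apply, map_smul, this]
  exact smul_comm _ _ _

lemma phiPlus_eq (x t : R) : phiPlus R x t = phiOp x t 1 := by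
  funext q
  rw [phiPlus, phiOp, phiCoeff, one_mul]

lemma phiMinus_eq (x : Rˣ) (t : R) : phiMinus R x t = phiOp ((x⁻¹ : Rˣ) : R) t (-1) := by
  funext q
  rw [phiMinus, phiOp, phiCoeff, neg_one_mul]

lemma isExpConj_psiStar (x t : R) (j : ℤ) : IsExpConj (phiOp x t 1) (psiStar R j)
    (PowerSeries.mk fun p : ℕ => hCoeff x t p • psiStar R (j - p)) := by
  have := isExpConj_mk (commute_phiOp x t one_ne_zero) (phiCoeff x t) (hCoeff x t)
    (hCoeff_zero x t)
    (fun N => by rw [hCoeff_rec]; exact sum_congr rfl fun i _ => (succ_mul_phiCoeff x t i _).symm)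
    (fun p => psiStar R (j - p)) fun q p v => by
      rw [phiOp, LinearMap.smul_apply, J_psiStar_smul, smul_add, LinearMap.smul_apply, one_mul,
        smul_comm]
      congr 4
      push_cast
      ring
  simpa using this

lemma isExpConj_psi (x t : R) (j : ℤ) : IsExpConj (phiOp x t 1) (psi R j)
    (PowerSeries.mk fun p : ℕ => gCoeff x t p • psi R (j + p)) := by
  have := isExpConj_mk (commute_phiOp x t one_ne_zero) (fun q => -phiCoeff x t q) (gCoeff x t)
    rfl
    (fun N => by
      rw [gCoeff_rec]
      refine sum_congr rfl fun i _ => ?_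
      have := succ_mul_phiCoeff x t i (gCoeff x t (N - (i + 1)))
      linear_combination this)
    (fun p => psi R (j + p)) fun q p v => by
      rw [phiOp, LinearMap.smul_apply, J_psi_smul, smul_sub, LinearMap.smul_apply, one_mul,
        smul_comm, sub_eq_add_neg, add_assoc, ← Nat.cast_add]
      exact congrArg _ (neg_smul (phiCoeff x t q) (psi R (j + ((p + q : ℕ) : ℤ)) • v)).symm
  simpa using this

lemma isInvConj_psi (x t : R) (j : ℤ) : IsInvConj (phiOp x t (-1)) (psi R j)
    (PowerSeries.mk fun p : ℕ => hCoeff x t p • psi R (j - p)) := by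
  have := isInvConj_mk (commute_phiOp x t (neg_ne_zero.mpr one_ne_zero)) (phiCoeff x t)
    (hCoeff x t) (hCoeff_zero x t)
    (fun N => by rw [hCoeff_rec]; exact sum_congr rfl fun i _ => (succ_mul_phiCoeff x t i _).symm)
    (fun p => psi R (j - p)) fun q p v => by
      rw [phiOp, LinearMap.smul_apply, J_psi_smul, smul_sub, LinearMap.smul_apply, neg_one_mul,
        smul_comm]
      congr 4
      push_cast
      ring
  simpa using this

end Matrix

/-! ### The two matrix elements as determinants -/

section MatrixElements

open CliffordAlgebra

variable {R : Type*} [CommRing R]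

lemma psi_list_mul_psi {m : ℕ} (mu : Fin m → ℤ) (j : ℤ) :
    (List.ofFn fun i => psi R (mu i)).reverse.prod * psi R j
      = (-1) ^ m * (psi R j * (List.ofFn fun i => psi R (mu i)).reverse.prod) := by
  rw [prod_mul_of_anticomm, List.length_reverse, List.length_ofFn]
  intro a ha
  rw [List.mem_reverse, List.mem_ofFn] at ha
  obtain ⟨i, rfl⟩ := ha
  exact eq_neg_of_add_eq_zero_left (psi_anticomm R _ _)

lemma vev_neg_one_pow_mul_crGen (m : ℕ) {c : A R} (hc : c ∈ crGen R) (a : A R) :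
    vev R ((-1) ^ m * (c * a)) = 0 := by
  rcases neg_one_pow_eq_or (A R) m with h | h <;>
    simp [h, vev_crGen_mul R hc]

lemma vev_mul_smul_psi (a : A R) (r : R) {k : ℤ} (hk : 1 ≤ k) : vev R (a * r • psi R k) = 0 := by
  rw [mul_smul_comm, map_smul, vev_mul_annGen R ⟨k, Or.inr ⟨hk, rfl⟩⟩, smul_zero]

lemma vevSeries_plus (x t : R) {n : ℕ} (lam : Fin (n + 1) → ℕ) (hlam_pos : ∀ i, 0 < lam i)
    (mu : Fin n → ℕ) (hmu_pos : ∀ i, 0 < mu i) :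
    vevSeries R (C (List.ofFn fun i => psi R (mu i)).reverse.prod
      * ((PowerSeries.mk fun p : ℕ => gCoeff x t p • psi R (0 + p)) * (List.ofFn fun j =>
        (PowerSeries.mk fun p : ℕ => hCoeff x t p • psiStar R (lam j - p))).prod))
    = (Matrix.of (Fin.cons (fun _ => -(1 + C t)) (fun i j => hWt (C t) (lam j) (mu i)) :
        Fin (n + 1) → Fin (n + 1) → R⟦X⟧)).det
      * (C x * X) ^ ((∑ i, lam i) - ∑ i, mu i) := by
  -- The conjugate of `ψ_{-1/2}` is not purely of annihilation type, as `wick_det` requires: the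
  -- term `p = 0` is a creation operator and is treated apart.
  have hsplit : (PowerSeries.mk fun p : ℕ => gCoeff x t p • psi R (0 + p))
      = C (psi R 0) + psiAnnSeries (gCoeff x t) := by
    ext p
    rw [map_add, coeff_mk, psiAnnSeries, coeff_mk, coeff_C]
    split_ifs with hp
    · simp [hp, gCoeff]
    · simp
  -- `ψ_{-1/2}` moves left through all the `ψ_{μ_i-1/2}` at the cost of a sign, and `⟨0|` kills it.
  have hcr : vevSeries R (C (List.ofFn fun i => psi R (mu i)).reverse.prod
      * (C (psi R 0) * (List.ofFn fun j =>
        (PowerSeries.mk fun p : ℕ => hCoeff x t p • psiStar R (lam j - p))).prod)) = 0 := by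
    rw [← mul_assoc, ← map_mul, psi_list_mul_psi fun i => (mu i : ℤ)]
    ext N
    rw [coeff_vevSeries, coeff_C_mul, map_zero, mul_assoc, mul_assoc,
      vev_neg_one_pow_mul_crGen _ ⟨0, Or.inr ⟨le_rfl, rfl⟩⟩]
  have hcons : C (List.ofFn fun i => psi R (mu i)).reverse.prod * psiAnnSeries (gCoeff x t)
      = (List.ofFn (Fin.cons (psiAnnSeries (gCoeff x t)) fun i => C (psi R (mu i)) :
          Fin (n + 1) → (A R)⟦X⟧)).reverse.prod := by
    rw [C_list_reverse_prod, List.ofFn_succ]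
    simp
  -- The first row has weight `0` because its entries `-(1 + t)(xX)^{λ_j}` depend on `λ_j` alone.
  have hdet := det_mul_pow (C x * X : R⟦X⟧) lam (Fin.cons 0 mu)
    (Matrix.of (Fin.cons (fun _ => -(1 + C t)) (fun i j => hWt (C t) (lam j) (mu i)) :
        Fin (n + 1) → Fin (n + 1) → R⟦X⟧)) (by
      intro i j
      refine Fin.cases (fun _ => by simp) (fun i h => ?_) i
      simp only [Matrix.of_apply, Fin.cons_succ] at h ⊢
      exact le_of_hWt_ne_zero h)
  rw [Fin.sum_univ_succ (fun i => (Fin.cons 0 mu : Fin (n + 1) → ℕ) i)] at hdet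
  simp only [Fin.cons_zero, Fin.cons_succ, zero_add] at hdet
  rw [hsplit, add_mul, mul_add, map_add, hcr, zero_add, ← mul_assoc, hcons, ← hdet]
  refine wick_det (scalarSeries R) (scalarSeries_commute R) _ (vevSeries_scalarSeries_mul R)
    (vevSeries_one R) _ _ _ (fun i j => ?_) fun i b => ?_
  · refine Fin.cases ?_ (fun i => ?_) i
    · simpa using psiAnnSeries_anticomm x t (hlam_pos j)
    · simp only [Fin.cons_succ, Matrix.of_apply]
      rw [psi_series_anticomm_psiStar]
      congr 1
      ext N
      rw [coeff_C_hWt_mul, coeff_mk]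
  · refine vevSeries_mul_eq_zero R fun p q => ?_
    refine Fin.cases ?_ (fun i => ?_) i
    · simp only [Fin.cons_zero, psiAnnSeries, coeff_mk]
      split_ifs with hq
      · simp
      · exact vev_mul_smul_psi _ _ (by omega)
    · simp only [Fin.cons_succ, coeff_C]
      have := hmu_pos i
      split_ifs with hq
      · simpa using vev_mul_smul_psi (coeff p b) 1 (k := mu i) (by omega)
      · simp

lemma vevSeries_minus (x t : R) {n : ℕ} (lam : Fin (n + 1) → ℕ) (hlam_pos : ∀ i, 0 < lam i)
    (mu : Fin n → ℕ) (k : ℕ) (hk : ∀ j, lam j < k) :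
    vevSeries R ((List.ofFn fun i => (PowerSeries.mk fun p : ℕ =>
        hCoeff x t p • psi R (((Fin.cons k mu : Fin (n + 1) → ℕ) i : ℤ) - p))).reverse.prod
      * C (List.ofFn fun j => psiStar R (lam j)).prod)
    = (Matrix.of (Fin.cons (fun _ => 1 + C t) (fun i j => hWt (C t) (mu i) (lam j)) :
        Fin (n + 1) → Fin (n + 1) → R⟦X⟧)).det
      * (C x * X) ^ (k + (∑ i, mu i) - ∑ i, lam i) := by
  have hM : (Fin.cons (fun _ => 1 + C t) (fun i j => hWt (C t) (mu i) (lam j)) :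
      Fin (n + 1) → Fin (n + 1) → R⟦X⟧)
      = fun i j => hWt (C t) ((Fin.cons k mu : Fin (n + 1) → ℕ) i) (lam j) := by
    funext i j
    refine Fin.cases ?_ (fun i => ?_) i
    · simp [hWt_of_lt (hk j)]
    · simp
  have hdet := det_mul_pow (C x * X : R⟦X⟧) (Fin.cons k mu) lam (Matrix.of fun j i =>
    hWt (C t) ((Fin.cons k mu : Fin (n + 1) → ℕ) i) (lam j)) fun i j h => le_of_hWt_ne_zero h
  -- In `det_mul_pow` the column weight is the larger one. Here the larger weights `k, μ_i` belong
  -- to the rows, hence the transposes.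
  rw [← Matrix.det_transpose, ← Matrix.det_transpose (Matrix.of fun j i => _),
    Fin.sum_univ_succ (fun i => (Fin.cons k mu : Fin (n + 1) → ℕ) i)] at hdet
  simp only [Fin.cons_zero, Fin.cons_succ] at hdet
  rw [hM, C_list_prod]
  refine Eq.trans ?_ hdet
  -- Conjugation mixes creation operators into the `ψ`, so they need not kill `|0⟩`. The
  -- `ψ*_{λ_j-1/2}` are unchanged and are killed by `⟨0|`, so the left version of Wick's theorem
  -- applies.
  refine wick_det_left (scalarSeries R) (scalarSeries_commute R) _ (vevSeries_scalarSeries_mul R)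
    (vevSeries_one R) _ _ _ (fun i j => ?_) fun i b => ?_
  · rw [psiStar_series_anticomm_psi]
    congr 1
    ext N
    simp only [Matrix.transpose_apply, Matrix.of_apply]
    rw [coeff_C_hWt_mul, coeff_mk]
  · refine vevSeries_mul_eq_zero R fun p q => ?_
    have := hlam_pos i
    rw [coeff_C]
    split_ifs with hq
    · exact vev_crGen_mul R ⟨lam i, Or.inl ⟨by omega, rfl⟩⟩ _
    · simp

variable [Algebra ℚ R]

/-- A matrix element whose generating function by degree is a multiple of a power of `X`. -/
lemma braExpKet_eq_of_coeff (x t : R) {ε : ℤ} (hε : ε ≠ 0) (m : FockDual R) (v : Fock R)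
    (d y : R) (D : ℕ)
    (h : ∀ N, pairing R m (expCoeff R (phiOp x t ε) N v)
      = coeff N (C d * (C y * X) ^ D : R⟦X⟧)) :
    braExpKet R m (phiOp x t ε) v = d * y ^ D := by
  obtain ⟨M, hM⟩ := braExpKet_eq_sum m (phiOp x t ε) v
    (braExpKet_support_finite R m (phiCoeff x t) ε hε v)
  -- The cutoff must also exceed `D`, so that the only nonzero degree is included.
  rw [hM (max M (D + 1)) (le_max_left _ _)]
  have e : ∀ N, coeff N (C d * (C y * X) ^ D : R⟦X⟧) = if N = D then d * y ^ D else 0 := fun N => by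
    rw [mul_pow, ← map_pow, ← mul_assoc, ← map_mul, coeff_C_mul_X_pow]
  simp only [h, e]
  rw [sum_ite_eq', if_pos (Finset.mem_range.mpr (by omega))]

lemma braExpKet_plus (x t : R) {n : ℕ} (lam : Fin (n + 1) → ℕ) (hlam_pos : ∀ i, 0 < lam i)
    (mu : Fin n → ℕ) (hmu_pos : ∀ i, 0 < mu i) (d : R)
    (hd : (Matrix.of (Fin.cons (fun _ => -(1 + C t)) (fun i j => hWt (C t) (lam j) (mu i)) :
        Fin (n + 1) → Fin (n + 1) → R⟦X⟧)).det = C d) :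
    braExpKet R (bra R mu) (phiPlus R x t) (psi R 0 • ket R lam)
      = d * x ^ ((∑ i, lam i) - ∑ i, mu i) := by
  rw [phiPlus_eq]
  refine braExpKet_eq_of_coeff x t one_ne_zero _ _ _ _ _ fun N => ?_
  rw [← hd, ← vevSeries_plus x t lam hlam_pos mu hmu_pos, ket_eq, smul_smul,
    IsExpConj.expCoeff_apply (commute_phiOp x t one_ne_zero) (fun q => ?_)
      ((isExpConj_psi x t 0).mul (IsExpConj.prod_ofFn fun i => isExpConj_psiStar x t (lam i))),
    bra_eq_mk, pairing_mk_smul_vac, coeff_vevSeries, coeff_C_mul]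
  rw [phiOp, LinearMap.smul_apply, J_vac R (by have := q.pos; positivity), smul_zero]

lemma braExpKet_minus (x t : R) {n : ℕ} (lam : Fin (n + 1) → ℕ) (hlam_pos : ∀ i, 0 < lam i)
    (mu : Fin n → ℕ) (k : ℕ) (hk : ∀ j, lam j < k) (d : R)
    (hd : (Matrix.of (Fin.cons (fun _ => 1 + C t) (fun i j => hWt (C t) (mu i) (lam j)) :
        Fin (n + 1) → Fin (n + 1) → R⟦X⟧)).det = C d) :
    braExpKet R (MulOpposite.op (psi R k) • bra R mu) (phiOp x t (-1)) (ket R lam)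
      = d * x ^ (k + (∑ i, mu i) - ∑ i, lam i) := by
  have hε : (-1 : ℤ) ≠ 0 := neg_ne_zero.mpr one_ne_zero
  have hbra : MulOpposite.op (psi R k) • bra R mu
      = MulOpposite.op (List.ofFn fun i =>
        psi R ((Fin.cons k mu : Fin (n + 1) → ℕ) i)).reverse.prod • vacBra R := by
    rw [bra, smul_smul, ← MulOpposite.op_mul, List.ofFn_succ]
    simp
  refine braExpKet_eq_of_coeff x t hε _ _ _ _ _ fun N => ?_
  rw [← hd, ← vevSeries_minus x t lam hlam_pos mu k hk, hbra, pairing_smul,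
    IsInvConj.map_expCoeff (commute_phiOp x t hε) (fun q v => ?_)
      (IsInvConj.prod_reverse_ofFn fun i => isInvConj_psi x t _),
    ket_eq, smul_smul, vacBra, pairing_mk_smul_vac, one_mul, coeff_vevSeries, coeff_mul_C]
  rw [phiOp, LinearMap.smul_apply, map_smul, pairing_vacBra_J R (by have := q.pos; omega),
    smul_zero]

end MatrixElements

end FreeFermion

/-! ### The theorem -/

open PowerSeries FreeFermion

theorem mainTheorem1 {R : Type*} [CommRing R] [Algebra ℚ R] {n : ℕ}
    (lam : Fin (n + 1) → ℕ) (hlam : StrictAnti lam) (hlam_pos : ∀ i, 0 < lam i)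
    (mu : Fin n → ℕ) (hmu : StrictAnti mu) (hmu_pos : ∀ i, 0 < mu i) :
    (∀ x t : R,
      (FreeFermion.Interlaces lam mu →
        FreeFermion.braExpKet R (FreeFermion.bra R mu) (FreeFermion.phiPlus R x t)
            (FreeFermion.psi R 0 • FreeFermion.ket R lam)
          = (-1) ^ (n + 1) * t ^ FreeFermion.rStat lam mu
            * (1 + t) ^ (FreeFermion.sStat lam mu - FreeFermion.rStat lam mu + 1)
            * x ^ ((∑ i, lam i) - ∑ i, mu i)) ∧
      (¬ FreeFermion.Interlaces lam mu →
        FreeFermion.braExpKet R (FreeFermion.bra R mu) (FreeFermion.phiPlus R x t)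
            (FreeFermion.psi R 0 • FreeFermion.ket R lam) = 0)) ∧
    (∀ (x : Rˣ) (t : R) (k : ℕ), lam 0 < k →
      (FreeFermion.Interlaces lam mu →
        FreeFermion.braExpKet R (MulOpposite.op (FreeFermion.psi R k) • FreeFermion.bra R mu)
            (FreeFermion.phiMinus R x t) (FreeFermion.ket R lam)
          = t ^ FreeFermion.lStat lam mu
            * (1 + t) ^ (FreeFermion.sStat lam mu - FreeFermion.rStat lam mu + 1)
            * ((x ^ ((∑ i, (lam i : ℤ)) - (∑ i, (mu i : ℤ)) - (k : ℤ)) : Rˣ) : R)) ∧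
      (¬ FreeFermion.Interlaces lam mu →
        FreeFermion.braExpKet R (MulOpposite.op (FreeFermion.psi R k) • FreeFermion.bra R mu)
            (FreeFermion.phiMinus R x t) (FreeFermion.ket R lam) = 0)) := by
  refine ⟨fun x t => ⟨fun h => ?_, fun h => ?_⟩, fun x t k hk => ?_⟩
  · refine braExpKet_plus x t lam hlam_pos mu hmu_pos _ ?_
    rw [(det_hWt_plus lam hlam mu hmu (C t : R⟦X⟧)).1 h]
    simp
  · rw [braExpKet_plus x t lam hlam_pos mu hmu_pos 0, zero_mul]
    rw [(det_hWt_plus lam hlam mu hmu (C t : R⟦X⟧)).2 h, map_zero]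
  · have hk' : ∀ j, lam j < k := fun j => (hlam.antitone (Fin.zero_le j)).trans_lt hk
    rw [phiMinus_eq]
    refine ⟨fun h => ?_, fun h => ?_⟩
    · rw [braExpKet_minus _ t lam hlam_pos mu k hk' (t ^ FreeFermion.lStat lam mu
        * (1 + t) ^ (FreeFermion.sStat lam mu - FreeFermion.rStat lam mu + 1))]
      · congr 1
        -- From `λ_1 < k` and `λ_{i+1} ≤ μ_i`: the natural-number exponent of `x⁻¹` is not truncated
        -- and equals the negative of the integer exponent in the statement.
        have hle : ∑ i, lam i ≤ k + ∑ i, mu i := by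
          rw [Fin.sum_univ_succ]
          exact add_le_add hk.le (Finset.sum_le_sum fun i _ => (h i).2)
        rw [← Units.val_pow_eq_pow_val, inv_pow, ← zpow_natCast, ← zpow_neg, Nat.cast_sub hle]
        congr 2
        push_cast
        ring
      · rw [(det_hWt_minus lam hlam mu hmu (C t : R⟦X⟧)).1 h]
        simp
    · rw [braExpKet_minus _ t lam hlam_pos mu k hk' 0, zero_mul]
      rw [(det_hWt_minus lam hlam mu hmu (C t : R⟦X⟧)).2 h, map_zero]
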